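/- Let $d\ge 0$. A Lebesgue measurable set $A\subset\mathbb R^d$ has locally finite perimeter ($A\in \mathrm{FP}_{\rm loc}$) if the distributional derivative of its indicator function is a locally finite $\mathbb R^d$-valued Radon measure $D\mathbf 1_A$, i.e. $\int\varphi\,dD\mathbf 1_A=-\int_A\nabla\varphi\,dx$ for all $\varphi\in C^1_c(\mathbb R^d)$. Let $|D\mathbf 1_A|$ denote the variation measure of $D\mathbf 1_A$ and $P(A)=|D\mathbf 1_A|(\mathbb R^d)\in[0,\infty]$ the perimeter of $A$. The set $A$ has finite perimeter if $A\in \mathrm{FP}_{\rm loc}$ and $P(A)<\infty$; it belongs to $\mathrm{FP}$ if moreover $\mathbf 1_A\in L^1(\mathbb R^d)$. 1. If $A,B\in \mathrm{FP}_{\rm loc}$, then $A\cup B,\ A\cap B\in \mathrm{FP}_{\rm loc}$ and, as measures, $$|D\mathbf 1_{A\cup B}|+|D\mathbf 1_{A\cap B}|\le |D\mathbf 1_A|+|D\mathbf 1_B| .$$ 2. If $A$ and $B$ have finite perimeter, then so do $A\cup B$ and $A\cap B$, and $$P(A\cup B)+P(A\cap B)\le P(A)+P(B).$$ If $A,B\in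 \mathrm{FP}$, then $A\cup B,\ A\cap B\in \mathrm{FP}$. 3. Let $(A_i)$ be a finite or countable family of sets of finite perimeter. (a) If the family is finite, then $\bigcup_iA_i$ has finite perimeter and $|D\mathbf 1_{\bigcup_iA_i}|\le\sum_i|D\mathbf 1_{A_i}|$ as measures. (b) If the measure $\sum_i|D\mathbf 1_{A_i}|$ is locally finite, then $\bigcup_iA_i\in \mathrm{FP}_{\rm loc}$ and $|D\mathbf 1_{\bigcup_iA_i}|\le\sum_i|D\mathbf 1_{A_i}|$ as measures. (c) If $\bigcup_iA_i\in \mathrm{FP}_{\rm loc}$ (with no assumption on the sum), then $|D\mathbf 1_{\bigcup_iA_i}|(U)\le\sum_i|D\mathbf 1_{A_i}|(U)$ for every open set $U\subset\mathbb R^d$; in particular (with $U=\mathbb R^d$) $P(\bigcup_iA_i)\le\sum_iP(A_i)$. -/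

import Mathlib

open MeasureTheory Set
open scoped ENNReal

/-- A locally finite `ℝ^d`-valued Radon measure on `ℝ^d`. Such a measure `ν` assigns a vector to
every bounded Borel set, countably additively on the Borel subsets of each bounded set; it is
recorded by its restrictions `onBall n = ν ⌞ B(0, n)`, which are honest vector measures and agree
with each other. -/
structure RadonVectorMeasure (d : ℕ) where
  /-- The restriction of the measure to the open ball of radius `n` about the origin. -/
  onBall : ℕ → VectorMeasure (EuclideanSpace ℝ (Fin d)) (EuclideanSpace ℝ (Fin d))
  restrict_onBall : ∀ m n : ℕ, m ≤ n → (onBall n).restrict (Metric.ball 0 (m : ℝ)) = onBall m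

namespace RadonVectorMeasure

variable {d : ℕ}

/-- The variation measure `|ν|`: on `B(0, n)` it is the variation of `ν ⌞ B(0, n)`, that is, the
supremum of `∑ |ν(Eᵢ)|` over finite measurable partitions. -/
noncomputable def variation (ν : RadonVectorMeasure d) : Measure (EuclideanSpace ℝ (Fin d)) :=
  ⨆ n : ℕ, (ν.onBall n).variation

theorem variation_onBall_mono (ν : RadonVectorMeasure d) :
    Monotone fun n : ℕ => (ν.onBall n).variation := by
  intro m n hmn
  have h := ν.restrict_onBall m n hmn
  change (ν.onBall m).variation ≤ (ν.onBall n).variation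
  rw [← h, VectorMeasure.variation_restrict Metric.isOpen_ball.measurableSet]
  exact Measure.restrict_le_self

/-- The variation measure is the increasing limit of the variations on the balls. -/
theorem variation_apply (ν : RadonVectorMeasure d) {B : Set (EuclideanSpace ℝ (Fin d))}
    (hB : MeasurableSet B) : ν.variation B = ⨆ n : ℕ, (ν.onBall n).variation B := by
  apply le_antisymm
  · let μ : Measure (EuclideanSpace ℝ (Fin d)) := Measure.ofMeasurable
      (fun s _ => ⨆ n : ℕ, (ν.onBall n).variation s) (by simp) (by
        intro f hf hd
        simp_rw [measure_iUnion hd hf, ENNReal.tsum_eq_iSup_sum]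
        rw [iSup_comm]
        refine iSup_congr fun s => ?_
        exact (ENNReal.finsetSum_iSup_of_monotone
          (fun i m n hmn => ν.variation_onBall_mono hmn (f i))).symm)
    have hμ : ν.variation ≤ μ := by
      refine iSup_le fun n => Measure.le_iff.2 fun s hs => ?_
      rw [Measure.ofMeasurable_apply s hs]
      exact le_iSup (fun n => (ν.onBall n).variation s) n
    have h := hμ B
    rwa [Measure.ofMeasurable_apply B hB] at h
  · exact iSup_le fun n => (le_iSup (fun n => (ν.onBall n).variation) n) B

end RadonVectorMeasure

/-- `ν` represents the distributional derivative `Df`: `∫ φ dν = - ∫ f ∇φ dx` for every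
`φ ∈ C¹_c(ℝ^d)`. The integral of `φ` against `ν` is computed in any ball containing the support
of `φ`. -/
def RepresentsDeriv {d : ℕ} (f : EuclideanSpace ℝ (Fin d) → ℝ) (ν : RadonVectorMeasure d) : Prop :=
  ∀ φ : EuclideanSpace ℝ (Fin d) → ℝ, ContDiff ℝ 1 φ → HasCompactSupport φ →
    ∀ n : ℕ, tsupport φ ⊆ Metric.ball 0 (n : ℝ) →
      ∫ᵛ x, φ x ∂•(ν.onBall n) = -∫ x, f x • gradient φ x

/-- `f ∈ BV_loc`: `f` is locally integrable and its distributional derivative is a locally finite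
Radon vector measure. -/
def LocallyBV {d : ℕ} (f : EuclideanSpace ℝ (Fin d) → ℝ) : Prop :=
  LocallyIntegrable f volume ∧ ∃ ν : RadonVectorMeasure d, RepresentsDeriv f ν

open Classical in
/-- The variation measure `|Df|` of a function `f ∈ BV_loc` (the representing measure is unique).
It has the junk value `0` for other functions. -/
noncomputable def variationMeasure {d : ℕ} (f : EuclideanSpace ℝ (Fin d) → ℝ) :
    Measure (EuclideanSpace ℝ (Fin d)) :=
  if h : LocallyBV f then h.2.choose.variation else 0

/-- `A` is a Lebesgue measurable set of locally finite perimeter, `A ∈ FP_loc`. -/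
def HasLocallyFinitePerimeter {d : ℕ} (A : Set (EuclideanSpace ℝ (Fin d))) : Prop :=
  NullMeasurableSet A volume ∧ LocallyBV (A.indicator fun _ => (1 : ℝ))

/-- The perimeter measure `|D1_A|` of a set of locally finite perimeter. -/
noncomputable def perimeterMeasure {d : ℕ} (A : Set (EuclideanSpace ℝ (Fin d))) :
    Measure (EuclideanSpace ℝ (Fin d)) :=
  variationMeasure (A.indicator fun _ => (1 : ℝ))

/-- The perimeter `P(A) = |D1_A|(ℝ^d)`. -/
noncomputable def perimeter {d : ℕ} (A : Set (EuclideanSpace ℝ (Fin d))) : ℝ≥0∞ :=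
  perimeterMeasure A univ

/-- `A` is a Lebesgue measurable set of finite perimeter: `D1_A` is a finite measure. -/
def HasFinitePerimeter {d : ℕ} (A : Set (EuclideanSpace ℝ (Fin d))) : Prop :=
  HasLocallyFinitePerimeter A ∧ perimeter A < ∞

/-- `A ∈ FP`: a set of finite perimeter whose indicator function is in `L¹`. -/
def IsFP {d : ℕ} (A : Set (EuclideanSpace ℝ (Fin d))) : Prop :=
  HasFinitePerimeter A ∧ volume A < ∞

/-! Everything rests on one inequality tested with vector fields
(`RepresentsDeriv.neg_integral_lattice_le`). If `f`, `h` take values in [0,1] with derivatives `ν`,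
`η`, and |φ|, |ψ| ≤ w, then -∫ (f + h - fh) div φ - ∫ fh div ψ ≤ ∫ w d|ν| + ∫ w d|η|. For
indicators, f + h - fh and fh are the indicators of union and intersection. When f = F is C¹, the
integrand equals div(Fφ) + h div X - ((1-h)φ + hψ)·∇F with X = (1-F)φ + Fψ. The first term
integrates to zero, and both X and (1-h)φ + hψ are pointwise convex combinations of φ and ψ, hence
bounded by w. A general `f` is mollified: by Fubini and uniform continuity of w, ∫ w|∇(ρ*f)| exceeds
∫ w d|ν| by an arbitrarily small amount. Two facts connect test fields with measures. On an open set
U the variation is the supremum over C¹ fields of norm at most one with compact support in U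
(`HasLocallyFinitePerimeter.perimeterMeasure_apply`). Conversely, a bound of the partial derivatives
by ∫ |φ| dμ produces a Radon derivative, by Hahn–Banach on L¹(μ)
(`exists_representsDeriv_of_abs_integral_le`). The latter gives membership in FP_loc; the former
gives the inequality on open sets, and outer regularity extends it to all sets. Countable unions are
limits of finite ones: for a fixed test field dominated convergence applies, and the bounds pass to
the limit. -/

section

open Filter Topology

/-! ### Vector measures: finite variation, integrals, construction from operators on L¹. -/

namespace MeasureTheory.VectorMeasure

/-- A vector measure with values in a Euclidean space has finite variation. -/
theorem isFiniteMeasure_variation {X : Type*} [MeasurableSpace X] {d : ℕ}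
    (ν : VectorMeasure X (EuclideanSpace ℝ (Fin d))) : IsFiniteMeasure ν.variation := by
  let p : Fin d → EuclideanSpace ℝ (Fin d) →L[ℝ] ℝ := fun i => EuclideanSpace.proj i
  let s : Fin d → SignedMeasure X :=
    fun i => ν.mapRange (p i : EuclideanSpace ℝ (Fin d) →+ ℝ) (p i).continuous
  -- The norm is at most the sum of the absolute values of the coordinates, each a signed measure of
  -- finite total variation.
  have hle : ν.variation ≤ ∑ i, (s i).totalVariation := by
    refine variation_le_of_forall_enorm_le fun t _ => ?_
    have h : ‖ν t‖ₑ ≤ ∑ i, ‖s i t‖ₑ := by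
      have h1 : ν t = ∑ i, EuclideanSpace.single i (ν t i) := by
        ext j
        simp [Finset.sum_apply]
      calc ‖ν t‖ₑ = ‖∑ i, EuclideanSpace.single i (ν t i)‖ₑ := by rw [← h1]
        _ ≤ ∑ i, ‖EuclideanSpace.single i (ν t i)‖ₑ := enorm_sum_le _ _
        _ = ∑ i, ‖s i t‖ₑ := by
          refine Finset.sum_congr rfl fun i _ => ?_
          rw [← ofReal_norm, PiLp.norm_single, ofReal_norm]
          rfl
    refine h.trans ?_
    rw [Measure.finsetSum_apply]
    exact Finset.sum_le_sum fun i _ => (s i).enorm_le_totalVariation t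
  exact isFiniteMeasure_of_le _ hle

variable {X F G H : Type*} [MeasurableSpace X] [NormedAddCommGroup F] [NormedSpace ℝ F]
  [NormedAddCommGroup G] [NormedSpace ℝ G] [NormedAddCommGroup H] [NormedSpace ℝ H]

/-- Constant vectors can be pulled out of the integral of a scalar function. -/
theorem integral_smul_const [CompleteSpace F] [CompleteSpace G] (ν : VectorMeasure X F)
    (B : H →L[ℝ] F →L[ℝ] G) {f : X → ℝ} (hf : ν.Integrable f) (c : H) :
    ∫ᵛ x, f x • c ∂[B; ν] = B c (∫ᵛ x, f x ∂•ν) := by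
  refine Integrable.induction
    (fun f : X → ℝ => ∫ᵛ x, f x • c ∂[B; ν] = B c (∫ᵛ x, f x ∂•ν)) ?_ ?_ ?_ ?_ hf
  · intro a s hs hνs
    have : IsFiniteMeasure (ν.restrict s).variation := by
      rw [variation_restrict hs]
      exact ⟨by simpa using hνs⟩
    have h : (fun x => s.indicator (fun _ => a) x • c) = s.indicator fun _ => a • c := by
      ext x
      by_cases hx : x ∈ s <;> simp [hx]
    rw [h, integral_indicator hs, integral_indicator hs, integral_const, integral_const]
    simp
  · intro f g _ hf hg h1 h2
    simp only [Pi.add_apply, add_smul]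
    rw [integral_fun_add (hf.smul_const c) (hg.smul_const c), integral_fun_add hf hg, h1, h2]
    exact ((B c).map_add _ _).symm
  · have h1 : ∀ f : X →₁[ν.variation] ℝ, ∫ᵛ x, f x • c ∂[B; ν] =
        ∫ᵛ x, ((ContinuousLinearMap.toSpanSingleton ℝ c).compLpL 1 ν.variation f) x ∂[B; ν] :=
      fun f => integral_congr_ae (by
        filter_upwards [(ContinuousLinearMap.toSpanSingleton ℝ c).coeFn_compLpL f] with x hx
        rw [hx]
        simp)
    simp only [h1]
    exact isClosed_eq (continuous_integral.comp (ContinuousLinearMap.continuous _))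
      ((B c).continuous.comp continuous_integral)
  · intro f g hfg _ h
    rw [← integral_congr_ae hfg, ← h]
    exact (integral_congr_ae (by filter_upwards [hfg] with x hx; rw [hx])).symm

/-- Multiplication by the indicator function of `b`, as an operator on `L¹`. -/
noncomputable def indicatorL1 (μ : Measure X) {b : Set X} (hb : MeasurableSet b) :
    (X →₁[μ] ℝ) →L[ℝ] (X →₁[μ] ℝ) :=
  LinearMap.mkContinuous
    { toFun := fun f => ((L1.integrable_coeFn f).indicator hb).toL1
      map_add' := fun f g => by
        rw [← Integrable.toL1_add]
        refine (Integrable.toL1_eq_toL1_iff _ _ _ _).2 ?_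
        filter_upwards [Lp.coeFn_add f g] with x hx
        by_cases hxb : x ∈ b
        · simpa [hxb] using hx
        · simp [hxb]
      map_smul' := fun c f => by
        rw [RingHom.id_apply, ← Integrable.toL1_smul]
        refine (Integrable.toL1_eq_toL1_iff _ _ _ _).2 ?_
        filter_upwards [Lp.coeFn_smul c f] with x hx
        by_cases hxb : x ∈ b
        · simpa [hxb] using hx
        · simp [hxb] } 1 (by
    intro f
    rw [one_mul, L1.norm_eq_integral_norm, L1.norm_eq_integral_norm]
    refine integral_mono_ae (L1.integrable_coeFn _).norm (L1.integrable_coeFn f).norm ?_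
    filter_upwards [Integrable.coeFn_toL1 ((L1.integrable_coeFn f).indicator hb)] with x hx
    simp only [LinearMap.coe_mk, AddHom.coe_mk]
    rw [hx]
    exact norm_indicator_le_norm_self _ _)

theorem indicatorL1_toL1 {μ : Measure X} {b : Set X} (hb : MeasurableSet b) {f : X → ℝ}
    (hf : Integrable f μ) : indicatorL1 μ hb hf.toL1 = (hf.indicator hb).toL1 := by
  refine (Integrable.toL1_eq_toL1_iff _ _ ((L1.integrable_coeFn _).indicator hb) _).2 ?_
  filter_upwards [hf.coeFn_toL1] with x hx
  by_cases hxb : x ∈ b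
  · rw [indicator_of_mem hxb, indicator_of_mem hxb, hx]
  · simp [hxb]

open Classical in
/-- The set function `s ↦ T 1ₛ` induced by an operator on `L¹`. -/
noncomputable def setFunOfL1 {μ : Measure X} (T : (X →₁[μ] ℝ) →L[ℝ] F) (s : Set X) : F :=
  if h : MeasurableSet s ∧ μ s ≠ ∞ then T (indicatorConstLp 1 h.1 h.2 1) else 0

theorem enorm_setFunOfL1_le {μ : Measure X} (T : (X →₁[μ] ℝ) →L[ℝ] F) (s : Set X) :
    ‖setFunOfL1 T s‖ₑ ≤ ‖T‖ₑ * μ s := by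
  unfold setFunOfL1
  split_ifs with h
  · refine (T.le_opENorm _).trans ?_
    gcongr
    refine enorm_indicatorConstLp_le.trans ?_
    simp
  · simp

/-- The vector measure on a set `b` of finite measure induced by an operator on `L¹`. -/
theorem exists_of_clm_L1 [CompleteSpace F] {μ : Measure X} (T : (X →₁[μ] ℝ) →L[ℝ] F)
    {b : Set X} (hb : MeasurableSet b) (hμb : μ b ≠ ∞) :
    ∃ ν : VectorMeasure X F, (∀ s, MeasurableSet s → ν s = setFunOfL1 T (s ∩ b)) ∧
      ∀ (f : X → ℝ) (hf : Integrable f μ), (∀ x, x ∉ b → f x = 0) →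
        ∫ᵛ x, f x ∂•ν = T hf.toL1 := by
  classical
  have : IsFiniteMeasure (‖T‖ₑ • μ.restrict b) :=
    ⟨by simpa using ENNReal.mul_lt_top (by simp) hμb.lt_top⟩
  -- Countable additivity comes for free from finite additivity and domination by the finite measure
  -- ‖T‖ μ⌞b.
  let ν : VectorMeasure X F := of_additive_of_le_measure (μ := ‖T‖ₑ • μ.restrict b)
    (fun s => if MeasurableSet s then setFunOfL1 T (s ∩ b) else 0)
    (fun s => by
      split_ifs with hs
      · simpa [hs] using enorm_setFunOfL1_le T (s ∩ b)
      · simp)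
    (fun s t hs ht hst => by
      have h1 : MeasurableSet (s ∩ b) ∧ μ (s ∩ b) ≠ ∞ :=
        ⟨hs.inter hb, ne_top_of_le_ne_top hμb (measure_mono inter_subset_right)⟩
      have h2 : MeasurableSet (t ∩ b) ∧ μ (t ∩ b) ≠ ∞ :=
        ⟨ht.inter hb, ne_top_of_le_ne_top hμb (measure_mono inter_subset_right)⟩
      have h3 : MeasurableSet ((s ∪ t) ∩ b) ∧ μ ((s ∪ t) ∩ b) ≠ ∞ :=
        ⟨(hs.union ht).inter hb, ne_top_of_le_ne_top hμb (measure_mono inter_subset_right)⟩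
      simp only [hs, ht, hs.union ht, if_true, setFunOfL1, dif_pos h1, dif_pos h2, dif_pos h3]
      rw [← _root_.map_add, ← indicatorConstLp_disjoint_union h1.1 h2.1 h1.2 h2.2
        (hst.mono inter_subset_left inter_subset_left)]
      congr! 2
      exact union_inter_distrib_right s t b)
    (fun s hs => by simp [hs])
  have hν : ∀ s, MeasurableSet s → ν s = setFunOfL1 T (s ∩ b) := fun s hs => by
    change (if MeasurableSet s then setFunOfL1 T (s ∩ b) else 0) = _
    simp [hs]
  have hvar : ν.variation ≤ ‖T‖ₑ • μ.restrict b := by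
    refine variation_le_of_forall_enorm_le fun s hs => ?_
    rw [hν s hs]
    simpa [hs] using enorm_setFunOfL1_le T (s ∩ b)
  have hvar' : ν.variation ≤ ‖T‖ₑ • μ :=
    hvar.trans (Measure.le_iff.2 fun s _ => by
      simp only [Measure.smul_apply, smul_eq_mul]
      gcongr
      exact Measure.restrict_le_self)
  refine ⟨ν, hν, fun f hf hfb => ?_⟩
  have hν_int : ∀ {f : X → ℝ}, Integrable f μ → Integrable f ν.variation := fun hf =>
    (hf.smul_measure (by simp)).mono_measure hvar'
  -- The support condition on `f` is not stable under the approximation used by the induction, so it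
  -- is replaced by a truncation to `b` on the right.
  have key : ∀ hf' : Integrable f μ, ∫ᵛ x, f x ∂•ν = T (indicatorL1 μ hb hf'.toL1) := by
    refine Integrable.induction (fun f : X → ℝ => ∀ hf' : Integrable f μ,
      ∫ᵛ x, f x ∂•ν = T (indicatorL1 μ hb hf'.toL1)) ?_ ?_ ?_ ?_ hf
    · intro c s hs hμs hf'
      have : IsFiniteMeasure (ν.restrict s).variation := by
        have := isFiniteMeasure_of_le _ hvar
        infer_instance
      have h1 : MeasurableSet (s ∩ b) ∧ μ (s ∩ b) ≠ ∞ :=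
        ⟨hs.inter hb, ne_top_of_le_ne_top hμb (measure_mono inter_subset_right)⟩
      rw [integral_indicator hs, integral_const, restrict_apply _ hs MeasurableSet.univ,
        univ_inter, hν s hs, setFunOfL1, dif_pos h1, indicatorL1_toL1,
        ContinuousLinearMap.lsmul_apply, ← _root_.map_smul]
      congr 1
      refine Lp.ext ?_
      filter_upwards [Lp.coeFn_smul c (indicatorConstLp 1 h1.1 h1.2 (1 : ℝ)),
        indicatorConstLp_coeFn (p := 1) (hs := h1.1) (hμs := h1.2) (c := (1 : ℝ)),
        (hf'.indicator hb).coeFn_toL1] with x h2 h3 h4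
      rw [h2, h4, Pi.smul_apply, h3]
      by_cases hxs : x ∈ s <;> by_cases hxb : x ∈ b <;> simp [hxs, hxb]
    · intro f g _ hf hg h1 h2 hfg
      have : hfg.toL1 = hf.toL1 + hg.toL1 := Integrable.toL1_add _ _ hf hg
      rw [integral_add (hν_int hf) (hν_int hg), h1 hf, h2 hg, this, _root_.map_add, _root_.map_add]
    · have h1 : ∀ f : X →₁[μ] ℝ,
          T (indicatorL1 μ hb (L1.integrable_coeFn f).toL1) = T (indicatorL1 μ hb f) :=
        fun f => by rw [Integrable.toL1_coeFn]
      -- Since |ν| ≤ ‖T‖ μ, integration against `ν` is a continuous functional on L¹(μ) itself,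
      -- which is where the closedness has to be checked.
      have hdom : DominatedFinMeasAdditive μ (ν.transpose (ContinuousLinearMap.lsmul ℝ ℝ))
          ‖T‖ := by
        refine ⟨fun s t hs ht _ _ hdisj => cbmApplyMeasure_union ν (ContinuousLinearMap.lsmul ℝ ℝ) hs ht hdisj,
          fun s hs hsf => ?_⟩
        refine (norm_cbmApplyMeasure_le ν (ContinuousLinearMap.lsmul ℝ ℝ) s).trans ?_
        have h1 := (hvar' s).trans_eq (Measure.smul_apply _ _ _)
        have h2 := ENNReal.toReal_mono (ENNReal.mul_ne_top (by simp) hsf.ne)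
          ((enorm_measure_le_variation ν s).trans h1)
        rw [ENNReal.toReal_mul, toReal_enorm, toReal_enorm] at h2
        refine (mul_le_of_le_one_left (norm_nonneg _)
          ContinuousLinearMap.opNorm_lsmul_le).trans h2
      have h2 : ∀ f : X →₁[μ] ℝ, ∫ᵛ x, f x ∂•ν = setToFun μ _ hdom f := fun f => by
        rw [integral_eq_setToFun]
        exact (setToFun_congr_measure_of_integrable _ (by simp) hvar' _ _ _
          (L1.integrable_coeFn f)).symm
      have h3 : {f : X →₁[μ] ℝ | ∀ hf' : Integrable f μ,
          ∫ᵛ x, f x ∂•ν = T (indicatorL1 μ hb hf'.toL1)} =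
          {f : X →₁[μ] ℝ | setToFun μ _ hdom f = T (indicatorL1 μ hb f)} := by
        ext f
        simp only [mem_ofPred_eq, h2 f]
        exact ⟨fun h => (h (L1.integrable_coeFn f)).trans (h1 f), fun h _ => h.trans (h1 f).symm⟩
      rw [h3]
      exact isClosed_eq (continuous_setToFun _)
        (T.continuous.comp (ContinuousLinearMap.continuous _))
    · intro f g hfg hf h hg
      have h1 : f =ᵐ[ν.variation] g :=
        ((Measure.absolutelyContinuous_of_le hvar').trans
          (Measure.smul_absolutelyContinuous)).ae_eq hfg
      rw [← integral_congr_ae h1, h hf, (Integrable.toL1_eq_toL1_iff _ _ hf hg).2 hfg]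
  rw [key hf, indicatorL1_toL1]
  congr 1
  refine (Integrable.toL1_eq_toL1_iff _ _ _ _).2 (Filter.Eventually.of_forall fun x => ?_)
  by_cases hx : x ∈ b <;> simp [hx, hfb x]

end MeasureTheory.VectorMeasure

/-! ### Cutoff functions and the variation as a supremum over vector fields. -/

section Cutoff

variable {E : Type*} [NormedAddCommGroup E] [NormedSpace ℝ E] [FiniteDimensional ℝ E]

/-- A `C¹` cutoff function between a compact set and an open neighbourhood of it. -/
theorem exists_contDiff_cutoff {K U : Set E} (hK : IsCompact K) (hU : IsOpen U) (hKU : K ⊆ U) :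
    ∃ χ : E → ℝ, ContDiff ℝ 1 χ ∧ HasCompactSupport χ ∧ tsupport χ ⊆ U ∧
      (∀ x, 0 ≤ χ x) ∧ (∀ x, χ x ≤ 1) ∧ ∀ x ∈ K, χ x = 1 := by
  obtain ⟨L, hL, hKL, hLU⟩ := exists_compact_between hK hU hKU
  obtain ⟨f, hf0, hf1, hf⟩ := exists_contMDiffMap_zero_one_of_isClosed (n := 1)
    (modelWithCornersSelf ℝ E) (isOpen_interior (s := L)).isClosed_compl hK.isClosed
    (disjoint_compl_left_iff_subset.2 hKL)
  have hsupp : tsupport f ⊆ L := by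
    refine closure_minimal (fun x hx => ?_) hL.isClosed
    by_contra hxL
    exact hx (hf0 fun h => hxL (interior_subset h))
  exact ⟨f, f.contMDiff.contDiff, HasCompactSupport.of_support_subset_isCompact hL
    (subset_closure.trans hsupp), hsupp.trans hLU, fun x => (hf x).1, fun x => (hf x).2,
    fun x hx => hf1 hx⟩

end Cutoff

namespace MeasureTheory.VectorMeasure

variable {E : Type*} [NormedAddCommGroup E] [InnerProductSpace ℝ E] [FiniteDimensional ℝ E]
  [MeasurableSpace E] [BorelSpace E]

/-- A measurable set is approximated from inside by a compact set on whose neighbourhoods any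
cutoff function integrates almost like the indicator function of the set. -/
theorem exists_isCompact_forall_cutoff (ν : VectorMeasure E E) [IsFiniteMeasure ν.variation]
    {p : Set E} (hp : MeasurableSet p) {ε : ℝ} (hε : 0 < ε) :
    ∃ K ⊆ p, IsCompact K ∧ ∃ W ⊇ p, IsOpen W ∧ ∀ (χ : E → ℝ) (e : E), Continuous χ →
      tsupport χ ⊆ W → (∀ x, 0 ≤ χ x) → (∀ x, χ x ≤ 1) → (∀ x ∈ K, χ x = 1) → ‖e‖ ≤ 1 →
        inner ℝ e (ν p) - ε ≤ ∫ᵛ x, χ x • e ∂[innerSL ℝ; ν] := by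
  have hε2 : ENNReal.ofReal (ε / 2) ≠ 0 := by simpa using hε
  obtain ⟨K, hKp, hK, hνK⟩ := hp.exists_isCompact_sdiff_lt (measure_ne_top ν.variation p) hε2
  obtain ⟨W, hpW, hW, hνW⟩ := p.exists_isOpen_lt_add (measure_ne_top ν.variation p) hε2
  refine ⟨K, hKp, hK, W, hpW, hW, fun χ e hχ hχW h0 h1 hχK he => ?_⟩
  -- `χ` and the indicator of `p` agree on `K` and off `W`, and differ by at most 1 in between, so
  -- this mass bounds the error.
  have hWK : ν.variation.real (W \ K) ≤ ε := by
    refine ENNReal.toReal_le_of_le_ofReal hε.le ?_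
    have h2 : W \ K ⊆ (W \ p) ∪ (p \ K) := fun x hx => by
      by_cases hxp : x ∈ p
      · exact Or.inr ⟨hxp, hx.2⟩
      · exact Or.inl ⟨hx.1, hxp⟩
    have h3 : ν.variation (W \ p) ≤ ENNReal.ofReal (ε / 2) := by
      rw [measure_sdiff hpW hp.nullMeasurableSet (measure_ne_top _ _)]
      exact tsub_le_iff_left.2 hνW.le
    calc ν.variation (W \ K) ≤ ν.variation (W \ p) + ν.variation (p \ K) :=
          (measure_mono h2).trans (measure_union_le _ _)
      _ ≤ ENNReal.ofReal (ε / 2) + ENNReal.ofReal (ε / 2) := add_le_add h3 hνK.le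
      _ = ENNReal.ofReal ε := by rw [← ENNReal.ofReal_add (by positivity) (by positivity)]; simp
  have hχi : ν.Integrable χ := Integrable.of_bound hχ.aestronglyMeasurable 1
    (Eventually.of_forall fun x => by rw [Real.norm_of_nonneg (h0 x)]; exact h1 x)
  have hpi : ν.Integrable (p.indicator fun _ => (1 : ℝ)) := (integrable_const 1).indicator hp
  have hval : ∫ᵛ x, p.indicator (fun _ => (1 : ℝ)) x • e ∂[innerSL ℝ; ν] = inner ℝ e (ν p) := by
    rw [integral_smul_const ν _ hpi, integral_indicator hp, integral_const]
    simp only [restrict_apply _ hp MeasurableSet.univ, univ_inter, ContinuousLinearMap.lsmul_apply,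
      one_smul]
    rfl
  have hsub : ∫ᵛ x, χ x • e ∂[innerSL ℝ; ν] -
      ∫ᵛ x, p.indicator (fun _ => (1 : ℝ)) x • e ∂[innerSL ℝ; ν] =
      ∫ᵛ x, (χ x • e - p.indicator (fun _ => (1 : ℝ)) x • e) ∂[innerSL ℝ; ν] :=
    (integral_fun_sub (hχi.smul_const e) (hpi.smul_const e)).symm
  have hbound : ‖∫ᵛ x, (χ x • e - p.indicator (fun _ => (1 : ℝ)) x • e) ∂[innerSL ℝ; ν]‖ ≤ ε := by
    refine norm_integral_le_integral_norm.trans ?_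
    refine (mul_le_of_le_one_left (by positivity) (norm_innerSL_le ℝ)).trans ?_
    refine le_trans ?_ hWK
    rw [← integral_indicator_one (hW.measurableSet.diff hK.measurableSet)]
    refine integral_mono ((hχi.smul_const e).sub (hpi.smul_const e)).norm
      ((integrable_const 1).indicator (hW.measurableSet.diff hK.measurableSet)) fun x => ?_
    simp only
    rw [← sub_smul, norm_smul]
    refine (mul_le_of_le_one_right (norm_nonneg _) he).trans ?_
    by_cases hxK : x ∈ K
    · simp [hxK, hχK x hxK, hKp hxK]
    by_cases hxW : x ∈ W
    · rw [indicator_of_mem (show x ∈ W \ K from ⟨hxW, hxK⟩), Real.norm_eq_abs, abs_le]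
      have := h0 x
      have := h1 x
      by_cases hxp : x ∈ p <;> simp only [hxp, indicator_of_mem, indicator_of_notMem,
        not_false_eq_true, Pi.one_apply] <;> constructor <;> linarith
    · have : χ x = 0 := image_eq_zero_of_notMem_tsupport fun h => hxW (hχW h)
      have hxp : x ∉ p := fun h => hxW (hpW h)
      simp [this, hxp, hxW]
  rw [← hsub, hval] at hbound
  linarith [(abs_le.1 hbound).1]

/-- The variation of a vector measure on an open set is approached by its values on vector fields
of norm at most one. -/
theorem exists_lt_integral_of_lt_variation (ν : VectorMeasure E E) [IsFiniteMeasure ν.variation]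
    {U : Set E} (hU : IsOpen U) {a : ℝ≥0∞} (ha : a < ν.variation U) :
    ∃ φ : E → E, ContDiff ℝ 1 φ ∧ HasCompactSupport φ ∧ tsupport φ ⊆ U ∧ (∀ x, ‖φ x‖ ≤ 1) ∧
      a < ENNReal.ofReal (∫ᵛ x, φ x ∂[innerSL ℝ; ν]) := by
  classical
  obtain ⟨P, hPU, hPd, hPm, hPa⟩ := ν.exists_lt_sum_of_lt_variation hU.measurableSet ha
  have hPa' : a.toReal < ∑ p ∈ P, ‖ν p‖ := by
    have h1 : ∑ p ∈ P, ‖ν p‖ₑ = ENNReal.ofReal (∑ p ∈ P, ‖ν p‖) := by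
      rw [ENNReal.ofReal_sum_of_nonneg fun _ _ => norm_nonneg _]
      simp
    rw [h1] at hPa
    exact (ENNReal.lt_ofReal_iff_toReal_lt ha.ne_top).1 hPa
  -- Each piece loses at most ε; the +1 keeps the total loss strictly below the gap and covers an
  -- empty `P`.
  let ε : ℝ := (∑ p ∈ P, ‖ν p‖ - a.toReal) / (P.card + 1)
  have hε : 0 < ε := div_pos (sub_pos.2 hPa') (by positivity)
  have h1 : ∀ p : Set E, ∃ K ⊆ p, IsCompact K ∧ (p ∈ P → ∃ W ⊇ p, IsOpen W ∧
      ∀ (χ : E → ℝ) (e : E), Continuous χ →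
      tsupport χ ⊆ W → (∀ x, 0 ≤ χ x) → (∀ x, χ x ≤ 1) → (∀ x ∈ K, χ x = 1) → ‖e‖ ≤ 1 →
        inner ℝ e (ν p) - ε ≤ ∫ᵛ x, χ x • e ∂[innerSL ℝ; ν]) := fun p => by
    by_cases hp : p ∈ P
    · obtain ⟨K, hKp, hK, W⟩ := ν.exists_isCompact_forall_cutoff (hPm p hp) hε
      exact ⟨K, hKp, hK, fun _ => W⟩
    · exact ⟨∅, empty_subset _, isCompact_empty, fun h => absurd h hp⟩
  choose K hKp hK hKW using h1
  -- Disjoint compact sets have disjoint neighbourhoods; cutoffs supported there never overlap, so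
  -- their sum keeps norm at most one.
  obtain ⟨O, hO, hOd⟩ := Set.PairwiseDisjoint.exists_mem_filter (t := (P : Set (Set E)))
    (l := fun p => 𝓝ˢ (K p)) (fun p hp q hq hpq => separatedNhds_iff_disjoint.1
      (SeparatedNhds.of_isCompact_isCompact (hK p) (hK q)
        ((hPd hp hq hpq).mono (hKp p) (hKp q)))) P.finite_toSet
  have h2 : ∀ p : Set E, ∃ χ : E → ℝ, p ∈ P → ContDiff ℝ 1 χ ∧ HasCompactSupport χ ∧
      tsupport χ ⊆ U ∧ tsupport χ ⊆ O p ∧ ∀ e : E, ‖e‖ ≤ 1 → (∀ x, ‖χ x • e‖ ≤ 1) ∧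
        inner ℝ e (ν p) - ε ≤ ∫ᵛ x, χ x • e ∂[innerSL ℝ; ν] := fun p => by
    by_cases hp : p ∈ P
    · obtain ⟨W, hpW, hW, hint⟩ := hKW p hp
      obtain ⟨V, hV, hKV, hVO⟩ := mem_nhdsSet_iff_exists.1 (hO p)
      obtain ⟨χ, hχ, hc, hs, h0, h1, hχK⟩ := exists_contDiff_cutoff (hK p)
        ((hU.inter hV).inter hW)
        (subset_inter (subset_inter ((hKp p).trans (hPU p hp)) hKV) ((hKp p).trans hpW))
      refine ⟨χ, fun _ => ⟨hχ, hc, fun x hx => (hs hx).1.1, fun x hx => hVO (hs hx).1.2,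
        fun e he => ⟨fun x => ?_, hint χ e hχ.continuous (fun x hx => (hs hx).2) h0 h1 hχK he⟩⟩⟩
      rw [norm_smul, Real.norm_of_nonneg (h0 x)]
      exact mul_le_one₀ (h1 x) (norm_nonneg _) he
    · exact ⟨0, fun h => absurd h hp⟩
  choose χ hχ using h2
  -- The direction of `ν p`; it is 0 when `ν p = 0`, which is harmless because only ‖e p‖ ≤ 1 and ⟨e
  -- p, ν p⟩ = ‖ν p‖ matter.
  let e : Set E → E := fun p => ‖ν p‖⁻¹ • ν p
  have he : ∀ p, ‖e p‖ ≤ 1 := fun p => by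
    simp only [e, norm_smul, norm_inv, norm_norm]
    exact inv_mul_le_one
  have hinner : ∀ p, inner ℝ (e p) (ν p) = ‖ν p‖ := fun p => by
    simp only [e, inner_smul_left, real_inner_self_eq_norm_sq]
    by_cases h : ‖ν p‖ = 0
    · simp [h]
    · simp only [map_inv₀, conj_trivial]
      field_simp
  have hsupp : tsupport (fun x => ∑ p ∈ P, χ p x • e p) ⊆ ⋃ p ∈ P, tsupport (χ p) := by
    refine closure_minimal (fun x hx => ?_)
      (isClosed_biUnion_finset fun p _ => isClosed_tsupport _)
    obtain ⟨p, hp, hne⟩ := Finset.exists_ne_zero_of_sum_ne_zero hx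
    exact mem_biUnion hp (subset_tsupport _ fun h => hne (by simp [h]))
  refine ⟨fun x => ∑ p ∈ P, χ p x • e p,
    ContDiff.sum fun p hp => (hχ p hp).1.smul contDiff_const,
    (P.isCompact_biUnion fun p hp => (hχ p hp).2.1.isCompact).of_isClosed_subset
      (isClosed_tsupport _) hsupp,
    hsupp.trans (iUnion₂_subset fun p hp => (hχ p hp).2.2.1), fun x => ?_, ?_⟩
  · by_cases hx : ∃ p ∈ P, x ∈ O p
    · obtain ⟨p, hp, hxp⟩ := hx
      have hsum : ∑ q ∈ P, χ q x • e q = χ p x • e p :=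
        Finset.sum_eq_single_of_mem p hp fun q hq hqp => by
          have : χ q x = 0 := image_eq_zero_of_notMem_tsupport fun h =>
            (disjoint_left.1 (hOd hq hp hqp)) ((hχ q hq).2.2.2.1 h) hxp
          simp [this]
      exact (congrArg norm hsum).trans_le (((hχ p hp).2.2.2.2 (e p) (he p)).1 x)
    · have hsum : ∑ q ∈ P, χ q x • e q = 0 := Finset.sum_eq_zero fun q hq => by
        have : χ q x = 0 := image_eq_zero_of_notMem_tsupport fun h =>
          hx ⟨q, hq, (hχ q hq).2.2.2.1 h⟩
        simp [this]
      simp [hsum]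
  · have hint : ∀ p ∈ P, ν.Integrable fun x => χ p x • e p := fun p hp =>
      Integrable.of_bound
        ((hχ p hp).1.continuous.smul continuous_const).aestronglyMeasurable 1
        (Eventually.of_forall ((hχ p hp).2.2.2.2 (e p) (he p)).1)
    rw [integral_finsetSum P hint, ENNReal.lt_ofReal_iff_toReal_lt ha.ne_top]
    have h3 : ∑ p ∈ P, (‖ν p‖ - ε) ≤ ∑ p ∈ P, ∫ᵛ x, χ p x • e p ∂[innerSL ℝ; ν] :=
      Finset.sum_le_sum fun p hp => by
        rw [← hinner p]
        exact ((hχ p hp).2.2.2.2 (e p) (he p)).2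
    refine lt_of_lt_of_le ?_ h3
    rw [Finset.sum_sub_distrib, Finset.sum_const, nsmul_eq_mul]
    have h4 : (P.card + 1 : ℝ) * ε = ∑ p ∈ P, ‖ν p‖ - a.toReal := by
      simp only [ε]
      field_simp
    linarith

end MeasureTheory.VectorMeasure

/-! ### Gradient, divergence and testing with vector fields. -/

/-- The divergence of a vector field. -/
noncomputable def divergence {d : ℕ}
    (φ : EuclideanSpace ℝ (Fin d) → EuclideanSpace ℝ (Fin d)) (x : EuclideanSpace ℝ (Fin d)) : ℝ :=
  ∑ i, gradient (fun y => φ y i) x i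

section Gradient

variable {E : Type*} [NormedAddCommGroup E] [InnerProductSpace ℝ E] [CompleteSpace E]

theorem ContDiff.continuous_gradient {f : E → ℝ} (hf : ContDiff ℝ 1 f) :
    Continuous (gradient f) :=
  (InnerProductSpace.toDual ℝ E).symm.continuous.comp (hf.continuous_fderiv one_ne_zero)

theorem tsupport_gradient_subset (f : E → ℝ) : tsupport (gradient f) ⊆ tsupport f :=
  closure_minimal (fun x hx => tsupport_fderiv_subset ℝ
    (subset_tsupport _ fun h => hx (by simp [gradient, h]))) (isClosed_tsupport _)

theorem HasCompactSupport.gradient {f : E → ℝ} (hf : HasCompactSupport f) :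
    HasCompactSupport (gradient f) :=
  hf.isCompact.of_isClosed_subset (isClosed_tsupport _) (tsupport_gradient_subset f)

theorem gradient_fun_mul {f g : E → ℝ} {x : E} (hf : DifferentiableAt ℝ f x)
    (hg : DifferentiableAt ℝ g x) :
    gradient (fun y => f y * g y) x = f x • gradient g x + g x • gradient f x := by
  rw [gradient, fderiv_fun_mul hf hg]
  simp [gradient]

end Gradient

section Divergence

variable {d : ℕ}

theorem ContDiff.apply_euclidean {φ : EuclideanSpace ℝ (Fin d) → EuclideanSpace ℝ (Fin d)}
    (hφ : ContDiff ℝ 1 φ) (i : Fin d) : ContDiff ℝ 1 fun x => φ x i :=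
  (contDiff_euclidean.1 hφ) i

theorem tsupport_apply_euclidean_subset
    (φ : EuclideanSpace ℝ (Fin d) → EuclideanSpace ℝ (Fin d)) (i : Fin d) :
    tsupport (fun x => φ x i) ⊆ tsupport φ :=
  closure_mono fun x hx h => hx (by simp [h])

theorem HasCompactSupport.apply_euclidean
    {φ : EuclideanSpace ℝ (Fin d) → EuclideanSpace ℝ (Fin d)} (hφ : HasCompactSupport φ)
    (i : Fin d) : HasCompactSupport fun x => φ x i :=
  hφ.isCompact.of_isClosed_subset (isClosed_tsupport _) (tsupport_apply_euclidean_subset φ i)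

theorem ContDiff.continuous_divergence
    {φ : EuclideanSpace ℝ (Fin d) → EuclideanSpace ℝ (Fin d)} (hφ : ContDiff ℝ 1 φ) :
    Continuous (divergence φ) :=
  continuous_finsetSum _ fun i _ =>
    (EuclideanSpace.proj (𝕜 := ℝ) i).continuous.comp (hφ.apply_euclidean i).continuous_gradient

theorem tsupport_divergence_subset
    (φ : EuclideanSpace ℝ (Fin d) → EuclideanSpace ℝ (Fin d)) :
    tsupport (divergence φ) ⊆ tsupport φ := by
  refine closure_minimal (fun x hx => ?_) (isClosed_tsupport _)
  obtain ⟨i, -, hi⟩ := Finset.exists_ne_zero_of_sum_ne_zero hx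
  exact tsupport_apply_euclidean_subset φ i (tsupport_gradient_subset _
    (subset_tsupport _ fun h => hi (by simp [h])))

theorem HasCompactSupport.divergence
    {φ : EuclideanSpace ℝ (Fin d) → EuclideanSpace ℝ (Fin d)} (hφ : HasCompactSupport φ) :
    HasCompactSupport (divergence φ) :=
  hφ.isCompact.of_isClosed_subset (isClosed_tsupport _) (tsupport_divergence_subset φ)

/-- The Leibniz rule for the divergence. -/
theorem divergence_smul {F : EuclideanSpace ℝ (Fin d) → ℝ}
    {φ : EuclideanSpace ℝ (Fin d) → EuclideanSpace ℝ (Fin d)} {x : EuclideanSpace ℝ (Fin d)}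
    (hF : DifferentiableAt ℝ F x) (hφ : DifferentiableAt ℝ φ x) :
    divergence (fun y => F y • φ y) x = F x * divergence φ x + inner ℝ (φ x) (gradient F x) := by
  have h : ∀ i, gradient (fun y => (F y • φ y) i) x i =
      F x * gradient (fun y => φ y i) x i + φ x i * gradient F x i := fun i => by
    have := gradient_fun_mul hF ((differentiableAt_euclidean.1 hφ) i)
    simp only [PiLp.smul_apply, smul_eq_mul]
    rw [this]
    simp
  simp only [divergence, h, Finset.sum_add_distrib, Finset.mul_sum, PiLp.inner_apply]
  congr 1
  exact Finset.sum_congr rfl fun i _ => by simp [mul_comm]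

/-- The divergence of a vector field pointing in a coordinate direction. -/
theorem divergence_smul_single (φ : EuclideanSpace ℝ (Fin d) → ℝ) (i : Fin d)
    (x : EuclideanSpace ℝ (Fin d)) :
    divergence (fun y => φ y • EuclideanSpace.single i (1 : ℝ)) x = gradient φ x i := by
  rw [divergence, Finset.sum_eq_single i]
  · simp
  · intro j _ hj
    simp [hj, gradient]
  · simp

/-- Testing with vector fields instead of scalar functions. -/
theorem RepresentsDeriv.integral_divergence {f : EuclideanSpace ℝ (Fin d) → ℝ}
    {ν : RadonVectorMeasure d} (h : RepresentsDeriv f ν) (hf : LocallyIntegrable f)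
    {φ : EuclideanSpace ℝ (Fin d) → EuclideanSpace ℝ (Fin d)} (hφ : ContDiff ℝ 1 φ)
    (hc : HasCompactSupport φ) {n : ℕ} (hn : tsupport φ ⊆ Metric.ball 0 (n : ℝ)) :
    ∫ᵛ x, φ x ∂[innerSL ℝ; ν.onBall n] = -∫ x, f x * divergence φ x := by
  have : IsFiniteMeasure (ν.onBall n).variation := (ν.onBall n).isFiniteMeasure_variation
  have hdec : ∀ x, φ x = ∑ i, φ x i • EuclideanSpace.single i (1 : ℝ) := fun x => by
    ext j
    simp [Finset.sum_apply, Pi.single_apply]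
  have hint : ∀ i, (ν.onBall n).Integrable fun x => φ x i := fun i =>
    (hφ.apply_euclidean i).continuous.integrable_of_hasCompactSupport (hc.apply_euclidean i)
  have hgrad : ∀ i, Integrable fun x => f x • gradient (fun y => φ y i) x := fun i =>
    hf.integrable_smul_right_of_hasCompactSupport (hφ.apply_euclidean i).continuous_gradient
      (hc.apply_euclidean i).gradient
  have hterm : ∀ i, ∫ᵛ x, φ x i • EuclideanSpace.single i (1 : ℝ) ∂[innerSL ℝ; ν.onBall n] =
      -∫ x, f x * gradient (fun y => φ y i) x i := fun i => by
    rw [VectorMeasure.integral_smul_const _ _ (hint i),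
      h _ (hφ.apply_euclidean i) (hc.apply_euclidean i) n
        ((tsupport_apply_euclidean_subset φ i).trans hn)]
    have h1 := (EuclideanSpace.proj (𝕜 := ℝ) i).integral_comp_comm (hgrad i)
    rw [ContinuousLinearMap.map_neg, neg_inj]
    refine (EuclideanSpace.inner_single_left i 1 _).trans ?_
    rw [map_one, one_mul]
    refine Eq.trans h1.symm ?_
    simp
  calc ∫ᵛ x, φ x ∂[innerSL ℝ; ν.onBall n]
      = ∫ᵛ x, ∑ i, φ x i • EuclideanSpace.single i (1 : ℝ) ∂[innerSL ℝ; ν.onBall n] := by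
        simp only [← hdec]
    _ = ∑ i, -∫ x, f x * gradient (fun y => φ y i) x i := by
        rw [VectorMeasure.integral_finsetSum _ fun i _ => (hint i).smul_const _]
        exact Finset.sum_congr rfl fun i _ => hterm i
    _ = -∫ x, f x * divergence φ x := by
        simp only [divergence, Finset.mul_sum]
        rw [integral_finsetSum _ fun i _ => ?_, Finset.sum_neg_distrib]
        exact (EuclideanSpace.proj (𝕜 := ℝ) i).integrable_comp (hgrad i)

end Divergence

/-! ### Radon derivatives from bounds on test functions. -/

/-- A linear functional on a space `V` that is bounded with respect to a seminorm pulled back from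
`H` is induced by a bounded functional on `H`. -/
theorem exists_clm_comp_eq {V H : Type*} [AddCommGroup V] [Module ℝ V] [NormedAddCommGroup H]
    [NormedSpace ℝ H] (J : V →ₗ[ℝ] H) (S : V →ₗ[ℝ] ℝ) {C : ℝ} (hS : ∀ v, |S v| ≤ C * ‖J v‖) :
    ∃ T : H →L[ℝ] ℝ, ∀ v, T (J v) = S v := by
  -- The bound makes `S` vanish on the kernel of `J`, so `S` factors algebraically through `J`; the
  -- factor is bounded on the range and extends by Hahn–Banach.
  have h1 : S ∈ LinearMap.range J.dualMap := by
    rw [LinearMap.range_dualMap_eq_dualAnnihilator_ker, Submodule.mem_dualAnnihilator]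
    intro v hv
    have := hS v
    rw [LinearMap.mem_ker.1 hv, norm_zero, mul_zero] at this
    exact abs_nonpos_iff.1 this
  obtain ⟨S', hS'⟩ := h1
  have h2 : ∀ v, S' (J v) = S v := fun v => by rw [← hS']; rfl
  let T₀ : LinearMap.range J →L[ℝ] ℝ := (S'.domRestrict (LinearMap.range J)).mkContinuous C (by
    rintro ⟨_, v, rfl⟩
    simpa [h2] using hS v)
  obtain ⟨T, hT, -⟩ := exists_extension_norm_eq (LinearMap.range J) T₀
  exact ⟨T, fun v => (hT ⟨J v, v, rfl⟩).trans (h2 v)⟩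

/-- The space of compactly supported `C¹` functions. -/
def contDiffCompactSupport (E : Type*) [NormedAddCommGroup E] [NormedSpace ℝ E] :
    Submodule ℝ (E → ℝ) where
  carrier := {φ | ContDiff ℝ 1 φ ∧ HasCompactSupport φ}
  add_mem' h1 h2 := ⟨h1.1.add h2.1, h1.2.add h2.2⟩
  zero_mem' := ⟨contDiff_const, HasCompactSupport.zero⟩
  smul_mem' c _ h := ⟨h.1.const_smul c, h.2.smul_left (f := fun _ => c)⟩

variable {d : ℕ}

theorem gradient_fun_add {E : Type*} [NormedAddCommGroup E] [InnerProductSpace ℝ E]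
    [CompleteSpace E] {f g : E → ℝ} {x : E} (hf : DifferentiableAt ℝ f x)
    (hg : DifferentiableAt ℝ g x) : gradient (f + g) x = gradient f x + gradient g x := by
  simp [gradient, fderiv_add hf hg]

theorem gradient_const_smul {E : Type*} [NormedAddCommGroup E] [InnerProductSpace ℝ E]
    [CompleteSpace E] {f : E → ℝ} {x : E} (hf : DifferentiableAt ℝ f x) (c : ℝ) :
    gradient (c • f) x = c • gradient f x := by
  simp [gradient, fderiv_const_smul hf c]

/-- A function whose partial derivatives are dominated by a locally finite measure has a
distributional derivative that is a Radon measure. -/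
theorem exists_representsDeriv_of_abs_integral_le {f : EuclideanSpace ℝ (Fin d) → ℝ}
    (hf : LocallyIntegrable f) (μ : Measure (EuclideanSpace ℝ (Fin d)))
    [IsLocallyFiniteMeasure μ]
    (h : ∀ φ : EuclideanSpace ℝ (Fin d) → ℝ, ContDiff ℝ 1 φ → HasCompactSupport φ →
      ∀ i, |∫ x, f x * gradient φ x i| ≤ ∫ x, |φ x| ∂μ) :
    ∃ ν : RadonVectorMeasure d, RepresentsDeriv f ν := by
  let V := contDiffCompactSupport (EuclideanSpace ℝ (Fin d))
  have hint : ∀ φ : V, Integrable φ.1 μ := fun φ =>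
    φ.2.1.continuous.integrable_of_hasCompactSupport φ.2.2
  have hgrad : ∀ φ : V, Integrable fun x => f x • gradient φ.1 x := fun φ =>
    hf.integrable_smul_right_of_hasCompactSupport φ.2.1.continuous_gradient φ.2.2.gradient
  have hgrad' : ∀ (φ : V) i, Integrable fun x => f x * gradient φ.1 x i := fun φ i =>
    (EuclideanSpace.proj (𝕜 := ℝ) i).integrable_comp (hgrad φ)
  have hdiff : ∀ (φ : V) x, DifferentiableAt ℝ φ.1 x := fun φ x =>
    φ.2.1.differentiable one_ne_zero x
  let J : V →ₗ[ℝ] (EuclideanSpace ℝ (Fin d) →₁[μ] ℝ) :=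
    { toFun := fun φ => (hint φ).toL1
      map_add' := fun φ ψ => Integrable.toL1_add _ _ (hint φ) (hint ψ)
      map_smul' := fun c φ => Integrable.toL1_smul _ (hint φ) c }
  let S : Fin d → V →ₗ[ℝ] ℝ := fun i =>
    { toFun := fun φ => -∫ x, f x * gradient φ.1 x i
      map_add' := fun φ ψ => by
        rw [← neg_add, ← integral_add (hgrad' φ i) (hgrad' ψ i)]
        congr 2 with x
        rw [Submodule.coe_add, gradient_fun_add (hdiff φ x) (hdiff ψ x), PiLp.add_apply, mul_add]
      map_smul' := fun c φ => by
        rw [RingHom.id_apply, smul_eq_mul, mul_neg, ← integral_const_mul]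
        congr 2 with x
        rw [Submodule.coe_smul, gradient_const_smul (hdiff φ x), PiLp.smul_apply, smul_eq_mul]
        ring }
  have hS : ∀ i, ∃ T : (EuclideanSpace ℝ (Fin d) →₁[μ] ℝ) →L[ℝ] ℝ, ∀ φ, T (J φ) = S i φ :=
    fun i => exists_clm_comp_eq J (S i) (C := 1) fun φ => by
      have h1 := h φ.1 φ.2.1 φ.2.2 i
      have h2 : ‖J φ‖ = ∫ x, |φ.1 x| ∂μ := (L1.norm_of_fun_eq_integral_norm (hint φ)).trans rfl
      rw [one_mul, h2]
      simpa [S] using h1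
  choose T hT using hS
  let T' : (EuclideanSpace ℝ (Fin d) →₁[μ] ℝ) →L[ℝ] EuclideanSpace ℝ (Fin d) :=
    ∑ i, (T i).smulRight (EuclideanSpace.single i (1 : ℝ))
  have hT' : ∀ φ : V, T' (J φ) = -∫ x, f x • gradient φ.1 x := fun φ => by
    ext j
    have h1 := (EuclideanSpace.proj (𝕜 := ℝ) j).integral_comp_comm (hgrad φ)
    have h2 : (∫ x, f x • gradient φ.1 x) j = ∫ x, f x * gradient φ.1 x j := by
      refine Eq.trans h1.symm ?_
      simp
    simp only [T', _root_.sum_apply, ContinuousLinearMap.smulRight_apply, hT]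
    rw [PiLp.neg_apply, h2]
    simp [S, Finset.sum_apply, Pi.single_apply]
  -- All balls use the same operator, so the resulting measures are automatically compatible.
  choose ν hν hνint using fun n : ℕ => VectorMeasure.exists_of_clm_L1 T'
    (Metric.isOpen_ball (x := (0 : EuclideanSpace ℝ (Fin d))) (ε := (n : ℝ))).measurableSet
    (measure_ball_lt_top (μ := μ)).ne
  refine ⟨⟨ν, fun m n hmn => ?_⟩, fun φ hφ hc n hn => ?_⟩
  · ext1 s hs
    rw [VectorMeasure.restrict_apply _ Metric.isOpen_ball.measurableSet hs,
      hν n _ (hs.inter Metric.isOpen_ball.measurableSet), hν m s hs, inter_assoc,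
      inter_eq_left.2 (Metric.ball_subset_ball (by exact_mod_cast hmn))]
  · rw [← hT' ⟨φ, hφ, hc⟩]
    exact hνint n φ (hint ⟨φ, hφ, hc⟩) fun x hx =>
      image_eq_zero_of_notMem_tsupport fun h => hx (hn h)

/-! ### The variation of a Radon vector measure and its test-field description. -/

namespace RadonVectorMeasure

theorem variation_onBall_le (ν : RadonVectorMeasure d) (n : ℕ) :
    (ν.onBall n).variation ≤ ν.variation :=
  le_iSup (fun n : ℕ => (ν.onBall n).variation) n

theorem variation_onBall_eq_restrict (ν : RadonVectorMeasure d) {m n : ℕ} (hmn : m ≤ n) :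
    (ν.onBall m).variation = (ν.onBall n).variation.restrict (Metric.ball 0 (m : ℝ)) := by
  rw [← ν.restrict_onBall m n hmn,
    VectorMeasure.variation_restrict Metric.isOpen_ball.measurableSet]

/-- Inside the ball of radius `m` the measures on larger balls add nothing, so the supremum is
attained at `m`; local finiteness follows. -/
theorem variation_ball (ν : RadonVectorMeasure d) (m : ℕ) :
    ν.variation (Metric.ball 0 (m : ℝ)) = (ν.onBall m).variation (Metric.ball 0 (m : ℝ)) := by
  rw [ν.variation_apply Metric.isOpen_ball.measurableSet]
  refine le_antisymm (iSup_le fun n => ?_)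
    (le_iSup (fun n : ℕ => (ν.onBall n).variation (Metric.ball 0 (m : ℝ))) m)
  rcases le_total n m with h | h
  · exact ν.variation_onBall_mono h _
  · rw [ν.variation_onBall_eq_restrict h, Measure.restrict_apply_self]

instance (ν : RadonVectorMeasure d) : IsLocallyFiniteMeasure ν.variation := by
  refine ⟨fun x => ?_⟩
  obtain ⟨n, hn⟩ := exists_nat_gt ‖x‖
  refine ⟨Metric.ball 0 (n : ℝ), Metric.isOpen_ball.mem_nhds (by simpa using hn), ?_⟩
  have := (ν.onBall n).isFiniteMeasure_variation
  rw [variation_ball]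
  exact measure_lt_top _ _

end RadonVectorMeasure

/-- The support of a compactly supported function lies in some ball of integer radius. -/
theorem HasCompactSupport.exists_tsupport_subset_ball {E F : Type*} [NormedAddCommGroup E]
    [Zero F] {φ : E → F} (hφ : HasCompactSupport φ) :
    ∃ n : ℕ, tsupport φ ⊆ Metric.ball 0 (n : ℝ) := by
  obtain ⟨r, hr⟩ := hφ.isCompact.isBounded.subset_ball 0
  obtain ⟨n, hn⟩ := exists_nat_ge r
  exact ⟨n, hr.trans (Metric.ball_subset_ball hn)⟩

section

variable {f : EuclideanSpace ℝ (Fin d) → ℝ} {ν : RadonVectorMeasure d}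

/-- The derivative of `f`, tested with a vector field, is controlled by its variation. -/
theorem RepresentsDeriv.neg_integral_divergence_le (h : RepresentsDeriv f ν)
    (hf : LocallyIntegrable f)
    {φ : EuclideanSpace ℝ (Fin d) → EuclideanSpace ℝ (Fin d)} (hφ : ContDiff ℝ 1 φ)
    (hc : HasCompactSupport φ) : -∫ x, f x * divergence φ x ≤ ∫ x, ‖φ x‖ ∂ν.variation := by
  obtain ⟨n, hn⟩ := hc.exists_tsupport_subset_ball
  rw [← h.integral_divergence hf hφ hc hn]
  refine (Real.le_norm_self _).trans (VectorMeasure.norm_integral_le_integral_norm.trans ?_)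
  refine (mul_le_of_le_one_left (by positivity) (norm_innerSL_le ℝ)).trans ?_
  exact integral_mono_measure (ν.variation_onBall_le n) (Eventually.of_forall fun _ => norm_nonneg _)
    (hφ.continuous.norm.integrable_of_hasCompactSupport hc.norm)

/-- The variation of the derivative of `f` on an open set is approached by testing with vector
fields of norm at most one. -/
theorem RepresentsDeriv.exists_lt_neg_integral_divergence (h : RepresentsDeriv f ν)
    (hf : LocallyIntegrable f) {U : Set (EuclideanSpace ℝ (Fin d))} (hU : IsOpen U) {a : ℝ≥0∞}
    (ha : a < ν.variation U) :
    ∃ φ : EuclideanSpace ℝ (Fin d) → EuclideanSpace ℝ (Fin d), ContDiff ℝ 1 φ ∧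
      HasCompactSupport φ ∧ tsupport φ ⊆ U ∧ (∀ x, ‖φ x‖ ≤ 1) ∧
        a < ENNReal.ofReal (-∫ x, f x * divergence φ x) := by
  rw [ν.variation_apply hU.measurableSet] at ha
  obtain ⟨n, hn⟩ := lt_iSup_iff.1 ha
  -- `U` is cut down to the ball so that the test field found below is supported where `ν.onBall n`
  -- computes its integral.
  rw [ν.variation_onBall_eq_restrict le_rfl, Measure.restrict_apply hU.measurableSet] at hn
  have := (ν.onBall n).isFiniteMeasure_variation
  obtain ⟨φ, hφ, hc, hs, h1, hlt⟩ :=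
    (ν.onBall n).exists_lt_integral_of_lt_variation (hU.inter Metric.isOpen_ball) hn
  refine ⟨φ, hφ, hc, hs.trans inter_subset_left, h1, ?_⟩
  rwa [← h.integral_divergence hf hφ hc (hs.trans inter_subset_right)]

/-- Testing with vector fields of norm at most one, supported in a given open set. -/
theorem RepresentsDeriv.ofReal_neg_integral_divergence_le (h : RepresentsDeriv f ν)
    (hf : LocallyIntegrable f) {U : Set (EuclideanSpace ℝ (Fin d))}
    {φ : EuclideanSpace ℝ (Fin d) → EuclideanSpace ℝ (Fin d)} (hφ : ContDiff ℝ 1 φ)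
    (hc : HasCompactSupport φ) (hs : tsupport φ ⊆ U) (h1 : ∀ x, ‖φ x‖ ≤ 1) :
    ENNReal.ofReal (-∫ x, f x * divergence φ x) ≤ ν.variation U := by
  refine (ENNReal.ofReal_le_ofReal (h.neg_integral_divergence_le hf hφ hc)).trans ?_
  rw [ofReal_integral_norm_eq_lintegral_enorm
    (hφ.continuous.integrable_of_hasCompactSupport hc)]
  refine le_trans (lintegral_mono fun x => ?_)
    ((lintegral_indicator_one (isClosed_tsupport φ).measurableSet).trans_le (measure_mono hs))
  by_cases hx : x ∈ tsupport φ
  · rw [indicator_of_mem hx, Pi.one_apply, ← ofReal_norm]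
    exact ENNReal.ofReal_le_one.2 (h1 x)
  · simp [hx, image_eq_zero_of_notMem_tsupport hx]

end

open scoped Convolution

/-! ### Mollification does not increase the weighted variation, up to a small error. -/

section Mollification

variable {f : EuclideanSpace ℝ (Fin d) → ℝ} {ρ : EuclideanSpace ℝ (Fin d) → ℝ}

/-- The derivative falls on `ρ`, and reflecting the argument changes its sign. The result is exactly
the distributional derivative of `f` tested with t ↦ ρ(x - t). -/
theorem gradient_convolution (hf : LocallyIntegrable f) (hρ : ContDiff ℝ 1 ρ)
    (hc : HasCompactSupport ρ) (x : EuclideanSpace ℝ (Fin d)) :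
    gradient (ρ ⋆[ContinuousLinearMap.lsmul ℝ ℝ, volume] f) x =
      -∫ t, f t • gradient (fun y => ρ (x - y)) t := by
  have h1 := (hc.hasFDerivAt_convolution_left (ContinuousLinearMap.lsmul ℝ ℝ) hρ hf x).fderiv
  rw [gradient, h1, convolution_eq_swap]
  have h2 : ∀ t, gradient (fun y => ρ (x - y)) t = -gradient ρ (x - t) := fun t => by
    have h5 : HasFDerivAt (fun y => ρ (x - y)) (-fderiv ℝ ρ (x - t)) t := by
      have h6 := (hρ.differentiable one_ne_zero (x - t)).hasFDerivAt.comp t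
        ((hasFDerivAt_id t).const_sub x)
      rwa [ContinuousLinearMap.comp_neg, ContinuousLinearMap.comp_id] at h6
    simp [gradient, h5.fderiv]
  have h3 : ∀ t, ContinuousLinearMap.precompL (EuclideanSpace ℝ (Fin d))
      (ContinuousLinearMap.lsmul ℝ ℝ) (fderiv ℝ ρ (x - t)) (f t) =
      f t • fderiv ℝ ρ (x - t) := fun t => by
    ext v
    simp [ContinuousLinearMap.precompL_apply, mul_comm]
  simp only [h2, h3, smul_neg, integral_neg, neg_neg]
  let D : StrongDual ℝ (EuclideanSpace ℝ (Fin d)) →L[ℝ] EuclideanSpace ℝ (Fin d) :=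
    { toFun := (InnerProductSpace.toDual ℝ (EuclideanSpace ℝ (Fin d))).symm
      map_add' := map_add _
      map_smul' := fun c L => by simp
      cont := (InnerProductSpace.toDual ℝ (EuclideanSpace ℝ (Fin d))).symm.continuous }
  have h4 := D.integral_comp_comm (μ := volume) (φ := fun t => f t • fderiv ℝ ρ (x - t))
    (hf.integrable_smul_right_of_hasCompactSupport
      ((hρ.continuous_fderiv one_ne_zero).comp (continuous_const.sub continuous_id))
      ((hc.fderiv (𝕜 := ℝ)).comp_homeomorph (Homeomorph.subLeft x)))
  refine h4.symm.trans (integral_congr_ae (Eventually.of_forall fun t => ?_))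
  exact D.map_smul _ _

/-- By `gradient_convolution`, the gradient at `x` is the integral of ρ(x - t) against the vector
measure. -/
theorem RepresentsDeriv.enorm_gradient_convolution_le {ν : RadonVectorMeasure d}
    (h : RepresentsDeriv f ν) (hf : LocallyIntegrable f) (hρ : ContDiff ℝ 1 ρ)
    (hc : HasCompactSupport ρ) (x : EuclideanSpace ℝ (Fin d)) :
    ‖gradient (ρ ⋆[ContinuousLinearMap.lsmul ℝ ℝ, volume] f) x‖ₑ ≤
      ∫⁻ t, ‖ρ (x - t)‖ₑ ∂ν.variation := by
  have hρ' : ContDiff ℝ 1 fun y => ρ (x - y) := hρ.comp (contDiff_const.sub contDiff_id)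
  have hc' : HasCompactSupport fun y => ρ (x - y) :=
    hc.comp_homeomorph (Homeomorph.subLeft x)
  obtain ⟨n, hn⟩ := hc'.exists_tsupport_subset_ball
  rw [gradient_convolution hf hρ hc, ← h _ hρ' hc' n hn]
  refine VectorMeasure.enorm_integral_le_lintegral_enorm.trans ?_
  have h1 : ‖ContinuousLinearMap.lsmul (E := EuclideanSpace ℝ (Fin d)) ℝ ℝ‖ₑ ≤ 1 := by
    rw [← ofReal_norm]
    exact ENNReal.ofReal_le_one.2 ContinuousLinearMap.opNorm_lsmul_le
  calc _ ≤ 1 * ∫⁻ t, ‖ρ (x - t)‖ₑ ∂(ν.onBall n).variation := by gcongr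
    _ ≤ _ := by
      rw [one_mul]
      exact lintegral_mono' (ν.variation_onBall_le n) le_rfl

/-- A mollification is an average of values of `f`. Staying in [0,1] is what makes the
interpolations with weights 1 - F and F convex. -/
theorem convolution_mem_Icc (hf0 : ∀ x, 0 ≤ f x) (hf1 : ∀ x, f x ≤ 1) (hρ : Continuous ρ)
    (hc : HasCompactSupport ρ) (hρ0 : ∀ x, 0 ≤ ρ x) (hρ1 : ∫ x, ρ x = 1)
    (x : EuclideanSpace ℝ (Fin d)) :
    (ρ ⋆[ContinuousLinearMap.lsmul ℝ ℝ, volume] f) x ∈ Icc (0 : ℝ) 1 := by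
  rw [convolution_def]
  refine ⟨integral_nonneg fun t => mul_nonneg (hρ0 t) (hf0 _), ?_⟩
  rw [← hρ1]
  exact integral_mono_of_nonneg (Eventually.of_forall fun t => mul_nonneg (hρ0 t) (hf0 _))
    (hρ.integrable_of_hasCompactSupport hc)
    (Eventually.of_forall fun t => mul_le_of_le_one_right (hρ0 t) (hf1 _))

/-- The weighted total variation of a mollification. -/
theorem RepresentsDeriv.lintegral_enorm_gradient_convolution_le {ν : RadonVectorMeasure d}
    (h : RepresentsDeriv f ν) (hf : LocallyIntegrable f) (hρ : ContDiff ℝ 1 ρ)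
    (hc : HasCompactSupport ρ) (hρ0 : ∀ x, 0 ≤ ρ x) (hρ1 : ∫ x, ρ x = 1) {r : ℝ}
    (hr : tsupport ρ ⊆ Metric.closedBall 0 r) {w : EuclideanSpace ℝ (Fin d) → ℝ}
    (hw : Continuous w) {δ : ℝ} (hδ : ∀ x y, dist x y ≤ r → w x ≤ w y + δ)
    {K : Set (EuclideanSpace ℝ (Fin d))} (hK : MeasurableSet K)
    (hwK : ∀ x y, w x ≠ 0 → dist x y ≤ r → y ∈ K) :
    ∫⁻ x, ENNReal.ofReal (w x) * ‖gradient (ρ ⋆[ContinuousLinearMap.lsmul ℝ ℝ, volume] f) x‖ₑ ≤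
      ∫⁻ t, ENNReal.ofReal (w t) ∂ν.variation + ENNReal.ofReal δ * ν.variation K := by
  have hmeas : Measurable fun p : EuclideanSpace ℝ (Fin d) × EuclideanSpace ℝ (Fin d) =>
      ENNReal.ofReal (w p.1) * ‖ρ (p.1 - p.2)‖ₑ :=
    ((hw.measurable.comp measurable_fst).ennreal_ofReal).mul
      ((hρ.continuous.comp (continuous_fst.sub continuous_snd)).measurable.enorm)
  have hmeas1 : ∀ x, Measurable fun t => ‖ρ (x - t)‖ₑ := fun x =>
    (hρ.continuous.comp (continuous_const.sub continuous_id)).measurable.enorm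
  have hmeas2 : ∀ t, Measurable fun x => ‖ρ (x - t)‖ₑ := fun t =>
    (hρ.continuous.comp (continuous_id.sub continuous_const)).measurable.enorm
  have hmass : ∀ t, ∫⁻ x, ‖ρ (x - t)‖ₑ = 1 := fun t => by
    rw [lintegral_sub_right_eq_self (fun x => ‖ρ x‖ₑ) t,
      ← ofReal_integral_norm_eq_lintegral_enorm
        (hρ.continuous.integrable_of_hasCompactSupport hc)]
    simp only [Real.norm_of_nonneg (hρ0 _), hρ1, ENNReal.ofReal_one]
  -- The kernel has mass one and lives at distance at most `r` from `t`, where `w` exceeds `w t` by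
  -- at most δ; the error only occurs for `t` in `K`.
  have hinner : ∀ t, ∫⁻ x, ENNReal.ofReal (w x) * ‖ρ (x - t)‖ₑ ≤
      ENNReal.ofReal (w t) + K.indicator (fun _ => ENNReal.ofReal δ) t := fun t => by
    calc ∫⁻ x, ENNReal.ofReal (w x) * ‖ρ (x - t)‖ₑ
        ≤ ∫⁻ x, (ENNReal.ofReal (w t) + K.indicator (fun _ => ENNReal.ofReal δ) t) *
            ‖ρ (x - t)‖ₑ := by
          refine lintegral_mono fun x => ?_
          by_cases hx : ρ (x - t) = 0
          · simp [hx]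
          by_cases hwx : w x = 0
          · simp [hwx]
          have hd : dist x t ≤ r := by
            have := hr (subset_tsupport _ hx)
            rwa [mem_closedBall_zero_iff, ← dist_eq_norm] at this
          gcongr
          rw [indicator_of_mem (hwK x t hwx hd)]
          exact (ENNReal.ofReal_le_ofReal (hδ x t hd)).trans ENNReal.ofReal_add_le
      _ = _ := by
          rw [lintegral_const_mul _ (hmeas2 t), hmass, mul_one]
  calc ∫⁻ x, ENNReal.ofReal (w x) *
        ‖gradient (ρ ⋆[ContinuousLinearMap.lsmul ℝ ℝ, volume] f) x‖ₑ
      ≤ ∫⁻ x, ∫⁻ t, ENNReal.ofReal (w x) * ‖ρ (x - t)‖ₑ ∂ν.variation := by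
        refine lintegral_mono fun x => ?_
        rw [lintegral_const_mul _ (hmeas1 x)]
        gcongr
        exact h.enorm_gradient_convolution_le hf hρ hc x
    _ = ∫⁻ t, ∫⁻ x, ENNReal.ofReal (w x) * ‖ρ (x - t)‖ₑ ∂volume ∂ν.variation :=
        lintegral_lintegral_swap hmeas.aemeasurable
    _ ≤ ∫⁻ t, (ENNReal.ofReal (w t) + K.indicator (fun _ => ENNReal.ofReal δ) t)
          ∂ν.variation := lintegral_mono hinner
    _ = _ := by
        rw [lintegral_add_left hw.measurable.ennreal_ofReal, lintegral_indicator_const hK]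

end Mollification

/-! ### The lattice inequality for functions. -/

/-- The integral of the divergence of a compactly supported vector field vanishes. -/
theorem integral_divergence_eq_zero
    {φ : EuclideanSpace ℝ (Fin d) → EuclideanSpace ℝ (Fin d)} (hφ : ContDiff ℝ 1 φ)
    (hc : HasCompactSupport φ) : ∫ x, divergence φ x = 0 := by
  have hgrad : ∀ i, Integrable fun x => gradient (fun y => φ y i) x i := fun i =>
    (EuclideanSpace.proj (𝕜 := ℝ) i).integrable_comp
      ((hφ.apply_euclidean i).continuous_gradient.integrable_of_hasCompactSupport
        (hc.apply_euclidean i).gradient)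
  simp only [divergence]
  rw [integral_finsetSum _ fun i _ => hgrad i]
  refine Finset.sum_eq_zero fun i _ => ?_
  have h1 : ∀ x, gradient (fun y => φ y i) x i =
      fderiv ℝ (fun y => φ y i) x (EuclideanSpace.single i 1) := fun x => by
    rw [← inner_gradient_left, EuclideanSpace.inner_single_right]
    simp
  have hint : Integrable fun x => φ x i :=
    (hφ.apply_euclidean i).continuous.integrable_of_hasCompactSupport (hc.apply_euclidean i)
  -- Integration by parts against the constant function 1.
  have h2 := integral_mul_fderiv_eq_neg_fderiv_mul_of_integrable (μ := volume)
    (f := fun _ : EuclideanSpace ℝ (Fin d) => (1 : ℝ)) (g := fun y => φ y i)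
    (v := EuclideanSpace.single i 1) (by simp) (by simpa [← h1] using hgrad i)
    (by simpa using hint) (fun x _ => differentiableAt_const _)
    (fun x _ => (hφ.apply_euclidean i).differentiable one_ne_zero x)
  simpa [← h1] using h2

theorem divergence_add {φ ψ : EuclideanSpace ℝ (Fin d) → EuclideanSpace ℝ (Fin d)}
    {x : EuclideanSpace ℝ (Fin d)} (hφ : DifferentiableAt ℝ φ x) (hψ : DifferentiableAt ℝ ψ x) :
    divergence (fun y => φ y + ψ y) x = divergence φ x + divergence ψ x := by
  simp only [divergence, ← Finset.sum_add_distrib]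
  refine Finset.sum_congr rfl fun i _ => ?_
  have h := gradient_fun_add ((differentiableAt_euclidean.1 hφ) i)
    ((differentiableAt_euclidean.1 hψ) i)
  exact congrArg (fun v : EuclideanSpace ℝ (Fin d) => v i) h

theorem gradient_one_sub {F : EuclideanSpace ℝ (Fin d) → ℝ} (x : EuclideanSpace ℝ (Fin d)) :
    gradient (fun y => 1 - F y) x = -gradient F x := by
  simp [gradient, fderiv_const_sub]

/-- The divergence of the interpolation `(1 - F) φ + F ψ`. -/
theorem divergence_one_sub_smul_add_smul {F : EuclideanSpace ℝ (Fin d) → ℝ}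
    {φ ψ : EuclideanSpace ℝ (Fin d) → EuclideanSpace ℝ (Fin d)} (hF : Differentiable ℝ F)
    (hφ : Differentiable ℝ φ) (hψ : Differentiable ℝ ψ) (x : EuclideanSpace ℝ (Fin d)) :
    divergence (fun y => (1 - F y) • φ y + F y • ψ y) x =
      (1 - F x) * divergence φ x - inner ℝ (φ x) (gradient F x) +
      (F x * divergence ψ x + inner ℝ (ψ x) (gradient F x)) := by
  have hF' : Differentiable ℝ fun y => 1 - F y := (differentiable_const 1).sub hF
  rw [divergence_add ((hF'.fun_smul hφ) x) ((hF.fun_smul hψ) x), divergence_smul (hF' x) (hφ x),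
    divergence_smul (hF x) (hψ x), gradient_one_sub, inner_neg_right, ← sub_eq_add_neg]

theorem norm_one_sub_smul_add_smul_le {E : Type*} [NormedAddCommGroup E] [NormedSpace ℝ E]
    {a b : E} {t c : ℝ} (ht0 : 0 ≤ t) (ht1 : t ≤ 1) (ha : ‖a‖ ≤ c) (hb : ‖b‖ ≤ c) :
    ‖(1 - t) • a + t • b‖ ≤ c := by
  have h1 : (1 - t) * ‖a‖ ≤ (1 - t) * c := mul_le_mul_of_nonneg_left ha (sub_nonneg.2 ht1)
  have h2 : t * ‖b‖ ≤ t * c := mul_le_mul_of_nonneg_left hb ht0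
  calc ‖(1 - t) • a + t • b‖ ≤ ‖(1 - t) • a‖ + ‖t • b‖ := norm_add_le _ _
    _ = (1 - t) * ‖a‖ + t * ‖b‖ := by
      rw [norm_smul, norm_smul, Real.norm_of_nonneg ht0, Real.norm_of_nonneg (sub_nonneg.2 ht1)]
    _ ≤ c := by linarith

/-- The lattice inequality for a `C¹` function `F` and a function `h` of locally bounded variation,
with the union and the intersection replaced by `F + h - F h` and `F h`. -/
theorem RepresentsDeriv.neg_integral_add_le {h F : EuclideanSpace ℝ (Fin d) → ℝ}
    {η : RadonVectorMeasure d} (hη : RepresentsDeriv h η) (hh : LocallyIntegrable h)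
    (hh0 : ∀ x, 0 ≤ h x) (hh1 : ∀ x, h x ≤ 1) (hF : ContDiff ℝ 1 F)
    (hF0 : ∀ x, 0 ≤ F x) (hF1 : ∀ x, F x ≤ 1)
    {φ ψ : EuclideanSpace ℝ (Fin d) → EuclideanSpace ℝ (Fin d)}
    (hφ : ContDiff ℝ 1 φ) (hφc : HasCompactSupport φ)
    (hψ : ContDiff ℝ 1 ψ) (hψc : HasCompactSupport ψ)
    {w : EuclideanSpace ℝ (Fin d) → ℝ} (hw : Continuous w) (hwc : HasCompactSupport w)
    (hφw : ∀ x, ‖φ x‖ ≤ w x) (hψw : ∀ x, ‖ψ x‖ ≤ w x) :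
    -∫ x, ((F x + h x - F x * h x) * divergence φ x + F x * h x * divergence ψ x) ≤
      ∫ x, w x ∂η.variation + ∫ x, w x * ‖gradient F x‖ := by
  have hF' : ContDiff ℝ 1 fun x => 1 - F x := contDiff_const.sub hF
  let X : EuclideanSpace ℝ (Fin d) → EuclideanSpace ℝ (Fin d) :=
    fun x => (1 - F x) • φ x + F x • ψ x
  have hX : ContDiff ℝ 1 X := (hF'.smul hφ).add (hF.smul hψ)
  have hsmul : ∀ {χ : EuclideanSpace ℝ (Fin d) → EuclideanSpace ℝ (Fin d)}
      (G : EuclideanSpace ℝ (Fin d) → ℝ), HasCompactSupport χ →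
      HasCompactSupport fun x => G x • χ x := fun G hχ =>
    hχ.mono fun x hx hχx => hx (by simp [hχx])
  have hXc : HasCompactSupport X := (hsmul (fun x => 1 - F x) hφc).add (hsmul F hψc)
  have hFφ : ContDiff ℝ 1 fun x => F x • φ x := hF.smul hφ
  have hFφc : HasCompactSupport fun x => F x • φ x := hsmul F hφc
  have hdF := hF.differentiable one_ne_zero
  have hdφ := hφ.differentiable one_ne_zero
  have hdψ := hψ.differentiable one_ne_zero
  have hdivX : ∀ x, divergence X x = (1 - F x) * divergence φ x - inner ℝ (φ x) (gradient F x) +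
      (F x * divergence ψ x + inner ℝ (ψ x) (gradient F x)) :=
    divergence_one_sub_smul_add_smul hdF hdφ hdψ
  have hdivFφ : ∀ x, divergence (fun y => F y • φ y) x =
      F x * divergence φ x + inner ℝ (φ x) (gradient F x) := fun x =>
    divergence_smul (hdF x) (hdφ x)
  have hinner : ∀ {χ : EuclideanSpace ℝ (Fin d) → EuclideanSpace ℝ (Fin d)}, ContDiff ℝ 1 χ →
      HasCompactSupport χ → Continuous (fun x => inner ℝ (χ x) (gradient F x)) ∧
        HasCompactSupport fun x => inner ℝ (χ x) (gradient F x) := fun {χ} hχ hχc =>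
    ⟨hχ.continuous.inner hF.continuous_gradient,
      hχc.mono fun x hx hχx => hx (by simp [hχx])⟩
  have iA : Integrable (divergence fun y => F y • φ y) :=
    hFφ.continuous_divergence.integrable_of_hasCompactSupport hFφc.divergence
  have iB : Integrable fun x => h x * divergence X x :=
    hh.integrable_smul_right_of_hasCompactSupport hX.continuous_divergence hXc.divergence
  have iC : Integrable fun x => inner ℝ (φ x) (gradient F x) +
      h x * (inner ℝ (ψ x) (gradient F x) - inner ℝ (φ x) (gradient F x)) :=
    ((hinner hφ hφc).1.integrable_of_hasCompactSupport (hinner hφ hφc).2).add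
      (hh.integrable_smul_right_of_hasCompactSupport
        ((hinner hψ hψc).1.sub (hinner hφ hφc).1) ((hinner hψ hψc).2.sub (hinner hφ hφc).2))
  have iW : Integrable fun x => w x * ‖gradient F x‖ :=
    (hw.mul hF.continuous_gradient.norm).integrable_of_hasCompactSupport hwc.mul_right
  -- The key identity, from the Leibniz rule: `h` is differentiated only through the admissible
  -- field `X`, and every other derivative falls on the C¹ function `F`.
  have hsplit : ∫ x, ((F x + h x - F x * h x) * divergence φ x + F x * h x * divergence ψ x) =
      (∫ x, divergence (fun y => F y • φ y) x) + (∫ x, h x * divergence X x) -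
        ∫ x, (inner ℝ (φ x) (gradient F x) +
          h x * (inner ℝ (ψ x) (gradient F x) - inner ℝ (φ x) (gradient F x))) := by
    rw [← integral_add iA iB]
    refine (integral_congr_ae (Eventually.of_forall fun x => ?_)).trans
      (integral_sub (iA.add iB) iC)
    simp only [hdivX, hdivFφ]
    ring
  have hXw : ∀ x, ‖X x‖ ≤ w x := fun x =>
    norm_one_sub_smul_add_smul_le (hF0 x) (hF1 x) (hφw x) (hψw x)
  have hB : -∫ x, h x * divergence X x ≤ ∫ x, w x ∂η.variation :=
    (hη.neg_integral_divergence_le hh hX hXc).trans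
      (integral_mono (hX.continuous.norm.integrable_of_hasCompactSupport hXc.norm)
        (hw.integrable_of_hasCompactSupport hwc) hXw)
  have hC : ∫ x, (inner ℝ (φ x) (gradient F x) +
      -- The integrand is (1-h) φ·∇F + h ψ·∇F, a convex combination of two terms bounded by w|∇F|.
      h x * (inner ℝ (ψ x) (gradient F x) - inner ℝ (φ x) (gradient F x))) ≤
      ∫ x, w x * ‖gradient F x‖ := by
    refine integral_mono iC iW fun x => ?_
    have h1 : inner ℝ (φ x) (gradient F x) ≤ w x * ‖gradient F x‖ :=
      (real_inner_le_norm _ _).trans (mul_le_mul_of_nonneg_right (hφw x) (norm_nonneg _))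
    have h2 : inner ℝ (ψ x) (gradient F x) ≤ w x * ‖gradient F x‖ :=
      (real_inner_le_norm _ _).trans (mul_le_mul_of_nonneg_right (hψw x) (norm_nonneg _))
    have h3 := mul_le_mul_of_nonneg_left h1 (sub_nonneg.2 (hh1 x))
    have h4 := mul_le_mul_of_nonneg_left h2 (hh0 x)
    simp only
    linarith
  rw [hsplit, integral_divergence_eq_zero hFφ hFφc]
  linarith

/-- The lattice inequality, tested with vector fields. -/
theorem RepresentsDeriv.neg_integral_lattice_le {f h : EuclideanSpace ℝ (Fin d) → ℝ}
    {ν η : RadonVectorMeasure d} (hν : RepresentsDeriv f ν) (hη : RepresentsDeriv h η)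
    (hf : LocallyIntegrable f) (hh : LocallyIntegrable h)
    (hf0 : ∀ x, 0 ≤ f x) (hf1 : ∀ x, f x ≤ 1) (hh0 : ∀ x, 0 ≤ h x) (hh1 : ∀ x, h x ≤ 1)
    {φ ψ : EuclideanSpace ℝ (Fin d) → EuclideanSpace ℝ (Fin d)}
    (hφ : ContDiff ℝ 1 φ) (hφc : HasCompactSupport φ)
    (hψ : ContDiff ℝ 1 ψ) (hψc : HasCompactSupport ψ)
    {w : EuclideanSpace ℝ (Fin d) → ℝ} (hw : Continuous w) (hwc : HasCompactSupport w)
    (hφw : ∀ x, ‖φ x‖ ≤ w x) (hψw : ∀ x, ‖ψ x‖ ≤ w x) :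
    -∫ x, ((f x + h x - f x * h x) * divergence φ x + f x * h x * divergence ψ x) ≤
      ∫ x, w x ∂ν.variation + ∫ x, w x ∂η.variation := by
  have hw0 : ∀ x, 0 ≤ w x := fun x => (norm_nonneg _).trans (hφw x)
  -- The outer radius is twice the inner one: this fixed ratio is what the almost everywhere
  -- convergence of the mollifications below requires.
  let b : ℕ → ContDiffBump (0 : EuclideanSpace ℝ (Fin d)) := fun k =>
    ⟨1 / (2 * ((k : ℝ) + 1)), 1 / ((k : ℝ) + 1), by positivity, by
      apply one_div_lt_one_div_of_lt <;> linarith [Nat.cast_nonneg (α := ℝ) k]⟩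
  have hbr : Tendsto (fun k => (b k).rOut) atTop (𝓝 0) := tendsto_one_div_add_atTop_nhds_zero_nat
  let F : ℕ → EuclideanSpace ℝ (Fin d) → ℝ := fun k =>
    (b k).normed volume ⋆[ContinuousLinearMap.lsmul ℝ ℝ, volume] f
  have hlim : ∀ᵐ x, Tendsto (fun k => F k x) atTop (𝓝 (f x)) :=
    ContDiffBump.ae_convolution_tendsto_right_of_locallyIntegrable (K := 2) hbr
      (Eventually.of_forall fun k => by
        simp only [b]
        field_simp
        exact le_rfl) hf
  have hρ : ∀ k, ContDiff ℝ 1 ((b k).normed volume) := fun k => (b k).contDiff_normed (n := 1)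
  have hF : ∀ k, ContDiff ℝ 1 (F k) := fun k =>
    (b k).hasCompactSupport_normed.contDiff_convolution_left (n := 1) _ (hρ k) hf
  have hF01 : ∀ k x, F k x ∈ Icc (0 : ℝ) 1 := fun k =>
    convolution_mem_Icc hf0 hf1 (hρ k).continuous (b k).hasCompactSupport_normed
      (b k).nonneg_normed (b k).integral_normed
  have hconv : Tendsto (fun k => -∫ x, ((F k x + h x - F k x * h x) * divergence φ x +
      F k x * h x * divergence ψ x)) atTop
      (𝓝 (-∫ x, ((f x + h x - f x * h x) * divergence φ x + f x * h x * divergence ψ x))) := by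
    refine Tendsto.neg (tendsto_integral_of_dominated_convergence
      (fun x => ‖divergence φ x‖ + ‖divergence ψ x‖) (fun k => ?_) ?_ (fun k => ?_) ?_)
    · have hFm := (hF k).continuous.aestronglyMeasurable (μ := volume)
      have hhm := hh.aestronglyMeasurable
      exact (((hFm.add hhm).sub (hFm.mul hhm)).mul
        hφ.continuous_divergence.aestronglyMeasurable).add
        ((hFm.mul hhm).mul hψ.continuous_divergence.aestronglyMeasurable)
    · exact (hφ.continuous_divergence.integrable_of_hasCompactSupport hφc.divergence).norm.add
        (hψ.continuous_divergence.integrable_of_hasCompactSupport hψc.divergence).norm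
    · refine Eventually.of_forall fun x => (norm_add_le _ _).trans (add_le_add ?_ ?_)
      · rw [norm_mul]
        refine mul_le_of_le_one_left (norm_nonneg _) ?_
        -- The coefficient lies in [0,1]: 1 - (F + h - Fh) = (1-F)(1-h) and F + h - Fh = h + F(1-h).
        have h1 := mul_nonneg (sub_nonneg.2 (hF01 k x).2) (sub_nonneg.2 (hh1 x))
        have h2 := mul_nonneg (hF01 k x).1 (sub_nonneg.2 (hh1 x))
        rw [Real.norm_eq_abs, abs_le]
        constructor <;> linarith [hh0 x]
      · rw [norm_mul]
        refine mul_le_of_le_one_left (norm_nonneg _) ?_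
        rw [Real.norm_of_nonneg (mul_nonneg (hF01 k x).1 (hh0 x))]
        exact mul_le_one₀ (hF01 k x).2 (hh0 x) (hh1 x)
    · filter_upwards [hlim] with x hx
      exact ((((hx.add_const _).sub (hx.mul_const _)).mul_const _)).add
        ((hx.mul_const _).mul_const _)
  -- A fixed compact set catching every point within a mollification radius (below 1) of the support
  -- of `w`; its finite mass determines δ.
  let K := Metric.cthickening 1 (tsupport w)
  have hK : IsCompact K := hwc.isCompact.cthickening
  have hwi : ∀ (μ : Measure (EuclideanSpace ℝ (Fin d))) [IsLocallyFiniteMeasure μ],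
      Integrable w μ := fun μ _ => hw.integrable_of_hasCompactSupport hwc
  refine le_of_forall_pos_le_add fun ε hε => ?_
  let δ : ℝ := ε / (ν.variation.real K + 1)
  have hδ : 0 < δ := by positivity
  have hδK : δ * ν.variation.real K ≤ ε := by
    simp only [δ]
    rw [div_mul_eq_mul_div, div_le_iff₀ (by positivity)]
    nlinarith
  obtain ⟨r, hr, hrw⟩ := Metric.uniformContinuous_iff.1
    (hwc.uniformContinuous_of_continuous hw) δ hδ
  refine le_of_tendsto hconv ?_
  filter_upwards [hbr.eventually (gt_mem_nhds hr), hbr.eventually (gt_mem_nhds one_pos)]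
    with k hk hk1
  have hgrad : ∫⁻ x, ENNReal.ofReal (w x) * ‖gradient (F k) x‖ₑ ≤
      ∫⁻ t, ENNReal.ofReal (w t) ∂ν.variation + ENNReal.ofReal δ * ν.variation K :=
    hν.lintegral_enorm_gradient_convolution_le hf (hρ k) (b k).hasCompactSupport_normed
      (b k).nonneg_normed (b k).integral_normed (b k).tsupport_normed_eq.subset hw
      (fun x y hxy => by
        have := hrw (hxy.trans_lt hk)
        rw [Real.dist_eq] at this
        linarith [(abs_lt.1 this).2]) hK.isClosed.measurableSet
      (fun x y hx hxy => Metric.mem_cthickening_of_dist_le y x 1 _ (subset_tsupport _ hx)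
        (by rw [dist_comm]; exact hxy.trans hk1.le))
  have hgrad' : ∫ x, w x * ‖gradient (F k) x‖ ≤ ∫ x, w x ∂ν.variation + ε := by
    have h1 : ∫ x, w x * ‖gradient (F k) x‖ =
        (∫⁻ x, ENNReal.ofReal (w x) * ‖gradient (F k) x‖ₑ).toReal := by
      rw [integral_eq_lintegral_of_nonneg_ae
        (Eventually.of_forall fun x => mul_nonneg (hw0 x) (norm_nonneg _))
        (hw.mul (hF k).continuous_gradient.norm).aestronglyMeasurable]
      simp only [ENNReal.ofReal_mul (hw0 _), ofReal_norm]
    have h2 : ∫⁻ t, ENNReal.ofReal (w t) ∂ν.variation ≠ ∞ :=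
      (hwi ν.variation).lintegral_lt_top.ne
    have h3 : ENNReal.ofReal δ * ν.variation K ≠ ∞ :=
      ENNReal.mul_ne_top ENNReal.ofReal_ne_top hK.measure_lt_top.ne
    rw [h1]
    refine (ENNReal.toReal_mono (ENNReal.add_ne_top.2 ⟨h2, h3⟩) hgrad).trans ?_
    rw [ENNReal.toReal_add h2 h3, ENNReal.toReal_mul, ENNReal.toReal_ofReal hδ.le,
      integral_eq_lintegral_of_nonneg_ae (Eventually.of_forall hw0) hw.aestronglyMeasurable]
    gcongr
    exact hδK
  have := hη.neg_integral_add_le hh hh0 hh1 (hF k) (fun x => (hF01 k x).1)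
    (fun x => (hF01 k x).2) hφ hφc hψ hψc hw hwc hφw hψw
  linarith

/-! ### Test fields, and submodularity of the perimeter measure. -/

/-- A `C¹` vector field of norm at most one with compact support in `U`. -/
structure IsTestField (U : Set (EuclideanSpace ℝ (Fin d)))
    (φ : EuclideanSpace ℝ (Fin d) → EuclideanSpace ℝ (Fin d)) : Prop where
  contDiff : ContDiff ℝ 1 φ
  hasCompactSupport : HasCompactSupport φ
  tsupport_subset : tsupport φ ⊆ U
  norm_le_one : ∀ x, ‖φ x‖ ≤ 1

theorem isTestField_zero (U : Set (EuclideanSpace ℝ (Fin d))) : IsTestField U fun _ => 0 where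
  contDiff := contDiff_const
  hasCompactSupport := HasCompactSupport.zero
  tsupport_subset := by simp [tsupport]
  norm_le_one := by simp

theorem divergence_zero (x : EuclideanSpace ℝ (Fin d)) :
    divergence (fun _ : EuclideanSpace ℝ (Fin d) => (0 : EuclideanSpace ℝ (Fin d))) x = 0 := by
  simp [divergence, gradient]

/-- The mass of a cutoff function with support in `U`. -/
theorem ofReal_integral_cutoff_le {μ : Measure (EuclideanSpace ℝ (Fin d))}
    [IsLocallyFiniteMeasure μ] {U : Set (EuclideanSpace ℝ (Fin d))}
    {w : EuclideanSpace ℝ (Fin d) → ℝ} (hw : Continuous w) (hwc : HasCompactSupport w)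
    (hwU : tsupport w ⊆ U) (hw0 : ∀ x, 0 ≤ w x) (hw1 : ∀ x, w x ≤ 1) :
    ENNReal.ofReal (∫ x, w x ∂μ) ≤ μ U := by
  rw [ofReal_integral_eq_lintegral_ofReal (hw.integrable_of_hasCompactSupport hwc)
    (Eventually.of_forall hw0)]
  refine le_trans (lintegral_mono fun x => ?_)
    ((lintegral_indicator_one (isClosed_tsupport w).measurableSet).trans_le (measure_mono hwU))
  by_cases hx : x ∈ tsupport w
  · rw [indicator_of_mem hx, Pi.one_apply]
    exact ENNReal.ofReal_le_one.2 (hw1 x)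
  · simp [hx, image_eq_zero_of_notMem_tsupport hx]

/-- Outer regularity of the larger measure suffices: open sets decreasing in `μ₂`-mass to that of
`s` bound the `μ₁`-mass of `s` as well. -/
theorem measure_le_of_forall_isOpen {μ₁ μ₂ : Measure (EuclideanSpace ℝ (Fin d))}
    [IsLocallyFiniteMeasure μ₂] (h : ∀ U, IsOpen U → μ₁ U ≤ μ₂ U) : μ₁ ≤ μ₂ := by
  refine Measure.le_iff.2 fun s _ => ?_
  rw [s.measure_eq_iInf_isOpen μ₂]
  exact le_iInf₂ fun U hU => le_iInf fun hUo => (measure_mono hU).trans (h U hUo)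

section Sets

variable {A B : Set (EuclideanSpace ℝ (Fin d))}

theorem locallyIntegrable_indicator_one (hA : NullMeasurableSet A) :
    LocallyIntegrable (A.indicator fun _ => (1 : ℝ)) :=
  (locallyIntegrable_const (1 : ℝ)).mono
    (aestronglyMeasurable_const.indicator₀ hA)
    (Eventually.of_forall fun _ => norm_indicator_le_norm_self _ _)

theorem integrable_indicator_mul_divergence (hA : NullMeasurableSet A)
    {φ : EuclideanSpace ℝ (Fin d) → EuclideanSpace ℝ (Fin d)} (hφ : ContDiff ℝ 1 φ)
    (hφc : HasCompactSupport φ) :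
    Integrable fun x => A.indicator (fun _ => (1 : ℝ)) x * divergence φ x :=
  (locallyIntegrable_indicator_one hA).integrable_smul_right_of_hasCompactSupport
    hφ.continuous_divergence hφc.divergence

theorem HasLocallyFinitePerimeter.exists_representsDeriv (hA : HasLocallyFinitePerimeter A) :
    ∃ ν : RadonVectorMeasure d, RepresentsDeriv (A.indicator fun _ => (1 : ℝ)) ν ∧
      perimeterMeasure A = ν.variation :=
  ⟨hA.2.2.choose, hA.2.2.choose_spec, dif_pos hA.2⟩

theorem HasLocallyFinitePerimeter.isLocallyFiniteMeasure (hA : HasLocallyFinitePerimeter A) :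
    IsLocallyFiniteMeasure (perimeterMeasure A) := by
  obtain ⟨ν, -, h⟩ := hA.exists_representsDeriv
  rw [h]
  infer_instance

theorem HasLocallyFinitePerimeter.isLocallyFiniteMeasure_add (hA : HasLocallyFinitePerimeter A)
    (hB : HasLocallyFinitePerimeter B) :
    IsLocallyFiniteMeasure (perimeterMeasure A + perimeterMeasure B) where
  finiteAtNhds x := by
    have := hA.isLocallyFiniteMeasure
    have := hB.isLocallyFiniteMeasure
    obtain ⟨s, hs, hsA⟩ := (perimeterMeasure A).finiteAt_nhds x
    obtain ⟨t, ht, htB⟩ := (perimeterMeasure B).finiteAt_nhds x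
    exact ⟨s ∩ t, inter_mem hs ht, ENNReal.add_lt_top.2
      ⟨(measure_mono inter_subset_left).trans_lt hsA,
        (measure_mono inter_subset_right).trans_lt htB⟩⟩

theorem HasLocallyFinitePerimeter.neg_integral_le (hA : HasLocallyFinitePerimeter A)
    {φ : EuclideanSpace ℝ (Fin d) → EuclideanSpace ℝ (Fin d)} (hφ : ContDiff ℝ 1 φ)
    (hφc : HasCompactSupport φ) :
    -∫ x, A.indicator (fun _ => (1 : ℝ)) x * divergence φ x ≤
      ∫ x, ‖φ x‖ ∂perimeterMeasure A := by
  obtain ⟨ν, hν, h⟩ := hA.exists_representsDeriv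
  rw [h]
  exact hν.neg_integral_divergence_le (locallyIntegrable_indicator_one hA.1) hφ hφc

/-- The perimeter in an open set is a supremum over test fields. -/
theorem HasLocallyFinitePerimeter.perimeterMeasure_apply (hA : HasLocallyFinitePerimeter A)
    {U : Set (EuclideanSpace ℝ (Fin d))} (hU : IsOpen U) :
    perimeterMeasure A U = ⨆ φ, ⨆ _ : IsTestField U φ,
      ENNReal.ofReal (-∫ x, A.indicator (fun _ => (1 : ℝ)) x * divergence φ x) := by
  obtain ⟨ν, hν, h⟩ := hA.exists_representsDeriv
  have hloc := locallyIntegrable_indicator_one hA.1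
  rw [h]
  refine le_antisymm (le_of_forall_lt fun a ha => ?_) (iSup₂_le fun φ hφ =>
    hν.ofReal_neg_integral_divergence_le hloc hφ.1 hφ.2 hφ.3 hφ.4)
  obtain ⟨φ, h1, h2, h3, h4, h5⟩ := hν.exists_lt_neg_integral_divergence hloc hU ha
  exact h5.trans_le (le_iSup₂_of_le φ ⟨h1, h2, h3, h4⟩ le_rfl)

/-- Fields ±χ e_i turn the one-sided bound for vector fields into a two-sided bound for each partial
derivative, to which `exists_representsDeriv_of_abs_integral_le` applies. -/
theorem hasLocallyFinitePerimeter_of_neg_integral_le (hA : NullMeasurableSet A)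
    (μ : Measure (EuclideanSpace ℝ (Fin d))) [IsLocallyFiniteMeasure μ]
    (h : ∀ φ : EuclideanSpace ℝ (Fin d) → EuclideanSpace ℝ (Fin d), ContDiff ℝ 1 φ →
      HasCompactSupport φ →
        -∫ x, A.indicator (fun _ => (1 : ℝ)) x * divergence φ x ≤ ∫ x, ‖φ x‖ ∂μ) :
    HasLocallyFinitePerimeter A := by
  have hloc := locallyIntegrable_indicator_one hA
  refine ⟨hA, hloc, exists_representsDeriv_of_abs_integral_le hloc μ fun φ hφ hφc i => ?_⟩
  have key : ∀ χ : EuclideanSpace ℝ (Fin d) → ℝ, ContDiff ℝ 1 χ → HasCompactSupport χ →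
      -∫ x, A.indicator (fun _ => (1 : ℝ)) x * gradient χ x i ≤ ∫ x, |χ x| ∂μ := fun χ hχ hχc => by
    have h1 := h (fun x => χ x • EuclideanSpace.single i (1 : ℝ)) (hχ.smul contDiff_const)
      (hχc.mono fun x hx hχx => hx (by simp [hχx]))
    simpa only [divergence_smul_single, norm_smul, PiLp.norm_single, norm_one, mul_one,
      Real.norm_eq_abs] using h1
  rw [abs_le]
  refine ⟨by linarith [key φ hφ hφc], ?_⟩
  have hneg : ∀ x, gradient (fun y => -φ y) x i = -gradient φ x i := fun x => by
    simp [gradient]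
  have h2 := key (fun x => -φ x) hφ.neg (hφc.mono fun x hx hφx => hx (by simp [hφx]))
  simpa only [hneg, mul_neg, integral_neg, neg_neg, abs_neg] using h2

theorem indicator_union_eq (x : EuclideanSpace ℝ (Fin d)) :
    (A ∪ B).indicator (fun _ => (1 : ℝ)) x = A.indicator (fun _ => (1 : ℝ)) x +
      B.indicator (fun _ => (1 : ℝ)) x -
        A.indicator (fun _ => (1 : ℝ)) x * B.indicator (fun _ => (1 : ℝ)) x := by
  by_cases hA : x ∈ A <;> by_cases hB : x ∈ B <;> simp [hA, hB]

theorem indicator_inter_eq (x : EuclideanSpace ℝ (Fin d)) :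
    (A ∩ B).indicator (fun _ => (1 : ℝ)) x =
      A.indicator (fun _ => (1 : ℝ)) x * B.indicator (fun _ => (1 : ℝ)) x := by
  by_cases hA : x ∈ A <;> by_cases hB : x ∈ B <;> simp [hA, hB]

/-- The lattice inequality for sets, tested with a pair of vector fields. -/
theorem HasLocallyFinitePerimeter.neg_integral_union_add_inter_le
    (hA : HasLocallyFinitePerimeter A) (hB : HasLocallyFinitePerimeter B)
    {φ ψ : EuclideanSpace ℝ (Fin d) → EuclideanSpace ℝ (Fin d)}
    (hφ : ContDiff ℝ 1 φ) (hφc : HasCompactSupport φ)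
    (hψ : ContDiff ℝ 1 ψ) (hψc : HasCompactSupport ψ)
    {w : EuclideanSpace ℝ (Fin d) → ℝ} (hw : Continuous w) (hwc : HasCompactSupport w)
    (hφw : ∀ x, ‖φ x‖ ≤ w x) (hψw : ∀ x, ‖ψ x‖ ≤ w x) :
    -(∫ x, (A ∪ B).indicator (fun _ => (1 : ℝ)) x * divergence φ x) +
        -(∫ x, (A ∩ B).indicator (fun _ => (1 : ℝ)) x * divergence ψ x) ≤
      ∫ x, w x ∂(perimeterMeasure A + perimeterMeasure B) := by
  obtain ⟨ν, hν, hAν⟩ := hA.exists_representsDeriv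
  obtain ⟨η, hη, hBη⟩ := hB.exists_representsDeriv
  have h01 : ∀ (C : Set (EuclideanSpace ℝ (Fin d))) x,
      0 ≤ C.indicator (fun _ => (1 : ℝ)) x ∧ C.indicator (fun _ => (1 : ℝ)) x ≤ 1 := fun C x => by
    by_cases hx : x ∈ C <;> simp [hx]
  have h := hν.neg_integral_lattice_le hη (locallyIntegrable_indicator_one hA.1)
    (locallyIntegrable_indicator_one hB.1) (fun x => (h01 A x).1) (fun x => (h01 A x).2)
    (fun x => (h01 B x).1) (fun x => (h01 B x).2) hφ hφc hψ hψc hw hwc hφw hψw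
  simp only [← indicator_union_eq] at h
  simp only [← indicator_inter_eq] at h
  rw [integral_add (integrable_indicator_mul_divergence (hA.1.union hB.1) hφ hφc)
    (integrable_indicator_mul_divergence (hA.1.inter hB.1) hψ hψc), neg_add] at h
  rwa [hAν, hBη, integral_add_measure (hw.integrable_of_hasCompactSupport hwc)
    (hw.integrable_of_hasCompactSupport hwc)]

/-- Taking ψ = 0 and w = |φ| in the tested lattice inequality leaves the bound for the union alone;
φ = 0 does the same for the intersection. -/
theorem HasLocallyFinitePerimeter.union (hA : HasLocallyFinitePerimeter A)
    (hB : HasLocallyFinitePerimeter B) : HasLocallyFinitePerimeter (A ∪ B) := by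
  have := hA.isLocallyFiniteMeasure_add hB
  refine hasLocallyFinitePerimeter_of_neg_integral_le (hA.1.union hB.1)
    (perimeterMeasure A + perimeterMeasure B) fun φ hφ hφc => ?_
  simpa [divergence_zero] using hA.neg_integral_union_add_inter_le hB hφ hφc
    (isTestField_zero univ).contDiff (isTestField_zero univ).hasCompactSupport
    hφ.continuous.norm hφc.norm (fun _ => le_rfl) (fun x => by simp)

theorem HasLocallyFinitePerimeter.inter (hA : HasLocallyFinitePerimeter A)
    (hB : HasLocallyFinitePerimeter B) : HasLocallyFinitePerimeter (A ∩ B) := by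
  have := hA.isLocallyFiniteMeasure_add hB
  refine hasLocallyFinitePerimeter_of_neg_integral_le (hA.1.inter hB.1)
    (perimeterMeasure A + perimeterMeasure B) fun φ hφ hφc => ?_
  simpa [divergence_zero] using hA.neg_integral_union_add_inter_le hB
    (isTestField_zero univ).contDiff (isTestField_zero univ).hasCompactSupport hφ hφc
    hφ.continuous.norm hφc.norm (fun x => by simp) (fun _ => le_rfl)

/-- Submodularity of the perimeter measure. -/
theorem HasLocallyFinitePerimeter.perimeterMeasure_union_add_inter_le
    (hA : HasLocallyFinitePerimeter A) (hB : HasLocallyFinitePerimeter B) :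
    perimeterMeasure (A ∪ B) + perimeterMeasure (A ∩ B) ≤
      perimeterMeasure A + perimeterMeasure B := by
  have := hA.isLocallyFiniteMeasure_add hB
  refine measure_le_of_forall_isOpen fun U hU => ?_
  rw [Measure.add_apply (perimeterMeasure (A ∪ B)), (hA.union hB).perimeterMeasure_apply hU,
    (hA.inter hB).perimeterMeasure_apply hU]
  have key : ∀ {φ ψ}, IsTestField U φ → IsTestField U ψ → ENNReal.ofReal
      (-(∫ x, (A ∪ B).indicator (fun _ => (1 : ℝ)) x * divergence φ x) +
        -(∫ x, (A ∩ B).indicator (fun _ => (1 : ℝ)) x * divergence ψ x)) ≤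
      (perimeterMeasure A + perimeterMeasure B) U := fun {φ ψ} hφ hψ => by
    -- One weight equal to 1 on both supports dominates both fields, so the two perimeters are
    -- estimated simultaneously.
    obtain ⟨w, hw, hwc, hwU, hw0, hw1, hwK⟩ := exists_contDiff_cutoff
      (hφ.hasCompactSupport.isCompact.union hψ.hasCompactSupport.isCompact) hU
      (union_subset hφ.tsupport_subset hψ.tsupport_subset)
    have hle : ∀ {χ : EuclideanSpace ℝ (Fin d) → EuclideanSpace ℝ (Fin d)}, IsTestField U χ →
        tsupport χ ⊆ tsupport φ ∪ tsupport ψ → ∀ x, ‖χ x‖ ≤ w x := fun {χ} hχ hs x => by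
      by_cases hx : x ∈ tsupport χ
      · exact (hχ.norm_le_one x).trans_eq (hwK x (hs hx)).symm
      · rw [image_eq_zero_of_notMem_tsupport hx, norm_zero]
        exact hw0 x
    exact (ENNReal.ofReal_le_ofReal (hA.neg_integral_union_add_inter_le hB hφ.contDiff
      hφ.hasCompactSupport hψ.contDiff hψ.hasCompactSupport hw.continuous hwc
      (hle hφ subset_union_left) (hle hψ subset_union_right))).trans
      (ofReal_integral_cutoff_le hw.continuous hwc hwU hw0 hw1)
  refine ENNReal.biSup_add_biSup_le' ⟨_, isTestField_zero U⟩ ⟨_, isTestField_zero U⟩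
    fun φ hφ ψ hψ => ?_
  -- `ENNReal.ofReal` truncates at 0 and is additive only for nonnegative terms; a nonpositive term
  -- is dropped by replacing its field with 0.
  rcases le_total 0 (-∫ x, (A ∪ B).indicator (fun _ => (1 : ℝ)) x * divergence φ x) with h1 | h1
  · rcases le_total 0 (-∫ x, (A ∩ B).indicator (fun _ => (1 : ℝ)) x * divergence ψ x) with h2 | h2
    · rw [← ENNReal.ofReal_add h1 h2]
      exact key hφ hψ
    · rw [ENNReal.ofReal_of_nonpos h2, add_zero]
      simpa [divergence_zero] using key hφ (isTestField_zero U)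
  · rw [ENNReal.ofReal_of_nonpos h1, zero_add]
    simpa [divergence_zero] using key (isTestField_zero U) hψ

theorem HasFinitePerimeter.perimeter_union_add_inter_le (hA : HasFinitePerimeter A)
    (hB : HasFinitePerimeter B) :
    perimeter (A ∪ B) + perimeter (A ∩ B) ≤ perimeter A + perimeter B :=
  hA.1.perimeterMeasure_union_add_inter_le hB.1 univ

theorem HasFinitePerimeter.union (hA : HasFinitePerimeter A) (hB : HasFinitePerimeter B) :
    HasFinitePerimeter (A ∪ B) :=
  ⟨hA.1.union hB.1, (le_self_add.trans (hA.perimeter_union_add_inter_le hB)).trans_lt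
    (ENNReal.add_lt_top.2 ⟨hA.2, hB.2⟩)⟩

theorem HasFinitePerimeter.inter (hA : HasFinitePerimeter A) (hB : HasFinitePerimeter B) :
    HasFinitePerimeter (A ∩ B) :=
  ⟨hA.1.inter hB.1, (le_add_self.trans (hA.perimeter_union_add_inter_le hB)).trans_lt
    (ENNReal.add_lt_top.2 ⟨hA.2, hB.2⟩)⟩

theorem hasLocallyFinitePerimeter_empty :
    HasLocallyFinitePerimeter (∅ : Set (EuclideanSpace ℝ (Fin d))) :=
  hasLocallyFinitePerimeter_of_neg_integral_le MeasurableSet.empty.nullMeasurableSet 0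
    fun φ _ _ => by simp

theorem perimeterMeasure_empty :
    perimeterMeasure (∅ : Set (EuclideanSpace ℝ (Fin d))) = 0 := by
  rw [← Measure.measure_univ_eq_zero,
    hasLocallyFinitePerimeter_empty.perimeterMeasure_apply isOpen_univ]
  simp

end Sets

/-! ### Finite and countable unions. -/

section Families

variable {ι : Type*} {A : ι → Set (EuclideanSpace ℝ (Fin d))}

theorem hasFinitePerimeter_biUnion (hA : ∀ i, HasFinitePerimeter (A i)) (s : Finset ι) :
    HasFinitePerimeter (⋃ i ∈ s, A i) ∧
      perimeterMeasure (⋃ i ∈ s, A i) ≤ ∑ i ∈ s, perimeterMeasure (A i) := by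
  classical
  induction s using Finset.induction_on with
  | empty =>
    have h : perimeterMeasure (∅ : Set (EuclideanSpace ℝ (Fin d))) = 0 := perimeterMeasure_empty
    simp only [Finset.notMem_empty, iUnion_of_empty, iUnion_empty, Finset.sum_empty]
    exact ⟨⟨hasLocallyFinitePerimeter_empty, by simp [perimeter, h]⟩, h.le⟩
  | insert i s hi ih =>
    rw [Finset.set_biUnion_insert, Finset.sum_insert hi]
    refine ⟨(hA i).union ih.1, ?_⟩
    calc perimeterMeasure (A i ∪ ⋃ j ∈ s, A j)
        ≤ perimeterMeasure (A i ∪ ⋃ j ∈ s, A j) + perimeterMeasure (A i ∩ ⋃ j ∈ s, A j) :=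
          Measure.le_add_right le_rfl
      _ ≤ perimeterMeasure (A i) + perimeterMeasure (⋃ j ∈ s, A j) :=
          (hA i).1.perimeterMeasure_union_add_inter_le ih.1.1
      _ ≤ _ := add_le_add_right ih.2 _

/-- At each point the indicators of finite unions are eventually constant along the finite subsets
of ι, and |g| dominates. -/
theorem tendsto_integral_indicator_biUnion [Countable ι] (hA : ∀ i, NullMeasurableSet (A i))
    {g : EuclideanSpace ℝ (Fin d) → ℝ} (hg : Integrable g) :
    Tendsto (fun s : Finset ι => -∫ x, (⋃ i ∈ s, A i).indicator (fun _ => (1 : ℝ)) x * g x) atTop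
      (𝓝 (-∫ x, (⋃ i, A i).indicator (fun _ => (1 : ℝ)) x * g x)) := by
  refine (tendsto_integral_filter_of_dominated_convergence (fun x => ‖g x‖)
    (Eventually.of_forall fun s => ?_) (Eventually.of_forall fun s => ?_) hg.norm ?_).neg
  · exact (locallyIntegrable_indicator_one
      (s.nullMeasurableSet_biUnion fun i _ => hA i)).aestronglyMeasurable.mul
      hg.aestronglyMeasurable
  · refine Eventually.of_forall fun x => ?_
    rw [norm_mul]
    exact mul_le_of_le_one_left (norm_nonneg _)
      ((norm_indicator_le_norm_self _ _).trans norm_one.le)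
  · exact Eventually.of_forall fun x => ((tendsto_indicator_biUnion_finset A _ x).mono_right
      (pure_le_nhds _)).mul_const _

theorem sum_perimeterMeasure_le (s : Finset ι) :
    ∑ i ∈ s, perimeterMeasure (A i) ≤ Measure.sum fun i => perimeterMeasure (A i) := by
  refine Measure.le_iff.2 fun t ht => ?_
  rw [Measure.finsetSum_apply, Measure.sum_apply _ ht]
  exact ENNReal.sum_le_tsum s

theorem hasLocallyFinitePerimeter_iUnion [Countable ι] (hA : ∀ i, HasFinitePerimeter (A i))
    [IsLocallyFiniteMeasure (Measure.sum fun i => perimeterMeasure (A i))] :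
    HasLocallyFinitePerimeter (⋃ i, A i) := by
  refine hasLocallyFinitePerimeter_of_neg_integral_le
    (NullMeasurableSet.iUnion fun i => (hA i).1.1)
    (Measure.sum fun i => perimeterMeasure (A i)) fun φ hφ hφc => ?_
  refine le_of_tendsto (tendsto_integral_indicator_biUnion (fun i => (hA i).1.1)
    (hφ.continuous_divergence.integrable_of_hasCompactSupport hφc.divergence))
    (Eventually.of_forall fun s => ?_)
  obtain ⟨hs, hle⟩ := hasFinitePerimeter_biUnion hA s
  exact (hs.1.neg_integral_le hφ hφc).trans (integral_mono_measure
    (hle.trans (sum_perimeterMeasure_le s)) (Eventually.of_forall fun _ => norm_nonneg _)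
    (hφ.continuous.norm.integrable_of_hasCompactSupport hφc.norm))

/-- Lower semicontinuity: for each test field the value on the full union is a limit of values on
finite unions, all bounded by the sum. Only open sets are covered, since the sum may fail to be
outer regular. -/
theorem perimeterMeasure_iUnion_apply_le [Countable ι] (hA : ∀ i, HasFinitePerimeter (A i))
    (hU : HasLocallyFinitePerimeter (⋃ i, A i)) {U : Set (EuclideanSpace ℝ (Fin d))}
    (hUo : IsOpen U) :
    perimeterMeasure (⋃ i, A i) U ≤ ∑' i, perimeterMeasure (A i) U := by
  rw [hU.perimeterMeasure_apply hUo]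
  refine iSup₂_le fun φ hφ => ?_
  refine le_of_tendsto (ENNReal.tendsto_ofReal (tendsto_integral_indicator_biUnion
    (fun i => (hA i).1.1) (hφ.contDiff.continuous_divergence.integrable_of_hasCompactSupport
      hφ.hasCompactSupport.divergence))) (Eventually.of_forall fun s => ?_)
  obtain ⟨hs, hle⟩ := hasFinitePerimeter_biUnion hA s
  calc _ ≤ perimeterMeasure (⋃ i ∈ s, A i) U := by
        rw [hs.1.perimeterMeasure_apply hUo]
        exact le_iSup₂_of_le φ hφ le_rfl
    _ ≤ ∑ i ∈ s, perimeterMeasure (A i) U := (hle U).trans_eq (Measure.finsetSum_apply _ _ _)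
    _ ≤ _ := ENNReal.sum_le_tsum s

/-- Local finiteness of the sum supplies the outer regularity that carries the estimate from open
sets to all sets. -/
theorem perimeterMeasure_iUnion_le [Countable ι] (hA : ∀ i, HasFinitePerimeter (A i))
    [IsLocallyFiniteMeasure (Measure.sum fun i => perimeterMeasure (A i))] :
    perimeterMeasure (⋃ i, A i) ≤ Measure.sum fun i => perimeterMeasure (A i) :=
  measure_le_of_forall_isOpen fun U hU => by
    rw [Measure.sum_apply _ hU.measurableSet]
    exact perimeterMeasure_iUnion_apply_le hA (hasLocallyFinitePerimeter_iUnion hA) hU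

end Families

end

theorem mainTheorem4 (d : ℕ) :
    -- unions and intersections in `FP_loc`
    (∀ A B : Set (EuclideanSpace ℝ (Fin d)),
      HasLocallyFinitePerimeter A → HasLocallyFinitePerimeter B →
        HasLocallyFinitePerimeter (A ∪ B) ∧ HasLocallyFinitePerimeter (A ∩ B) ∧
          perimeterMeasure (A ∪ B) + perimeterMeasure (A ∩ B)
            ≤ perimeterMeasure A + perimeterMeasure B) ∧
    -- unions and intersections of sets of finite perimeter
    (∀ A B : Set (EuclideanSpace ℝ (Fin d)),
      HasFinitePerimeter A → HasFinitePerimeter B →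
        HasFinitePerimeter (A ∪ B) ∧ HasFinitePerimeter (A ∩ B) ∧
          perimeter (A ∪ B) + perimeter (A ∩ B) ≤ perimeter A + perimeter B) ∧
    -- unions and intersections in `FP`
    (∀ A B : Set (EuclideanSpace ℝ (Fin d)),
      IsFP A → IsFP B → IsFP (A ∪ B) ∧ IsFP (A ∩ B)) ∧
    -- finite families
    (∀ (ι : Type) [Finite ι] (A : ι → Set (EuclideanSpace ℝ (Fin d))),
      (∀ i, HasFinitePerimeter (A i)) →
        HasFinitePerimeter (⋃ i, A i) ∧
          perimeterMeasure (⋃ i, A i) ≤ Measure.sum fun i => perimeterMeasure (A i)) ∧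
    -- countable families whose perimeter measures have a locally finite sum
    (∀ (ι : Type) [Countable ι] (A : ι → Set (EuclideanSpace ℝ (Fin d))),
      (∀ i, HasFinitePerimeter (A i)) →
        IsLocallyFiniteMeasure (Measure.sum fun i => perimeterMeasure (A i)) →
          HasLocallyFinitePerimeter (⋃ i, A i) ∧
            perimeterMeasure (⋃ i, A i) ≤ Measure.sum fun i => perimeterMeasure (A i)) ∧
    -- arbitrary countable families, on open sets
    (∀ (ι : Type) [Countable ι] (A : ι → Set (EuclideanSpace ℝ (Fin d))),
      (∀ i, HasFinitePerimeter (A i)) → HasLocallyFinitePerimeter (⋃ i, A i) →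
        ∀ U : Set (EuclideanSpace ℝ (Fin d)), IsOpen U →
          perimeterMeasure (⋃ i, A i) U ≤ ∑' i, perimeterMeasure (A i) U) := by
  refine ⟨fun A B hA hB => ⟨hA.union hB, hA.inter hB, hA.perimeterMeasure_union_add_inter_le hB⟩,
    fun A B hA hB => ⟨hA.union hB, hA.inter hB, hA.perimeter_union_add_inter_le hB⟩,
    fun A B hA hB => ⟨⟨hA.1.union hB.1, measure_union_lt_top hA.2 hB.2⟩,
      hA.1.inter hB.1, (measure_mono inter_subset_left).trans_lt hA.2⟩,
    fun ι _ A hA => ?_,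
    fun ι _ A hA _ => ⟨hasLocallyFinitePerimeter_iUnion hA, perimeterMeasure_iUnion_le hA⟩,
    fun ι _ A hA hU U hUo => perimeterMeasure_iUnion_apply_le hA hU hUo⟩
  have := Fintype.ofFinite ι
  have h := hasFinitePerimeter_biUnion hA Finset.univ
  simp only [Finset.mem_univ, iUnion_true] at h
  exact ⟨h.1, h.2.trans (sum_perimeterMeasure_le _)⟩
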